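/- Let $k$ be an algebraically closed field of characteristic zero, let $m,n\ge 0$ be integers, and let $\mathfrak g=\mathfrak{gl}(m,n)$ over $k$, with even part $\mathfrak g_0=\mathfrak{gl}(m)\times\mathfrak{gl}(n)$ and $\mathfrak g_1^+$ the odd block upper triangular matrices; put $\mathfrak p=\mathfrak g_0\oplus\mathfrak g_1^+$. Let $\mathfrak h$ be the subalgebra of diagonal matrices, with $\epsilon_1,\dots,\epsilon_m,\delta_1,\dots,\delta_n$ the basis of $\mathfrak h^*$ given by the diagonal entries, and let $(\ ,\ )$ be the symmetric bilinear form on $\mathfrak h^*$ with $(\epsilon_i,\epsilon_j)=\delta_{ij}$ and $(\delta_i,\delta_j)=-\delta_{ij}$ (Kronecker symbols on the right) and $(\epsilon_i,\delta_j)=0$. With respect to the Borel subalgebra of upper triangular matrices, let $\Delta_0^+$ and $\Delta_1^+$ be the sets of even and odd positive roots, and let $\rho=\frac12\sum_{\alpha\in\Delta_0^+}\alpha-\frac12\sum_{\alpha\in\Delta_1^+}\alpha$. Let $P^+$ be the set of $\lambda\in\mathfrak h^*$ such that $(\lambda,\alpha^\vee)$ is a nonnegative integer for all $\alpha\in\Delta_0^+$,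 where $\alpha^\vee=2\alpha/(\alpha,\alpha)$. For $\mu\in\mathfrak h^*$ let $L(\mu)$ be the simple $\mathfrak g$-module of highest weight $\mu$ with respect to this Borel subalgebra, that is, the quotient of the Verma module of highest weight $\mu$ by the sum of its proper submodules. For $\lambda\in P^+$ let $L^0(\lambda)$ be the simple $\mathfrak g_0$-module of highest weight $\lambda$, regarded as a $\mathfrak p$-module on which $\mathfrak g_1^+$ acts by zero, and let $K(\lambda)=U(\mathfrak g)\otimes_{U(\mathfrak p)}L^0(\lambda)$ be the Kac module. **Theorem.** Let $1\le r\le m$ and $1\le s\le n$. If $\lambda$ and $\lambda-\epsilon_r+\delta_s$ belong to $P^+$ and $(\lambda+\rho,\epsilon_r-\delta_s)=0$, then the simple module $L(\lambda-\epsilon_r+\delta_s)$ occurs as a composition factor of $K(\lambda)$, that is, $$[K(\lambda):L(\lambda-\epsilon_r+\delta_s)]\neq 0.$$ -/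

import Mathlib

noncomputable section

namespace GLSuper

open scoped TensorProduct

/-! ### The Lie superalgebra `gl(m,n)` and its sub-superalgebras -/

/-- Row and column labels of `(m+n) × (m+n)` matrices: `inl i` is the label of `ε_i`,
`inr j` the label of `δ_j`. -/
abbrev Idx (m n : ℕ) : Type := Fin m ⊕ Fin n

/-- The parity of a label. -/
def parity {m n : ℕ} : Idx m n → ZMod 2 := Sum.elim (fun _ => 0) (fun _ => 1)

/-- The position of a label in the ordering `ε_1, …, ε_m, δ_1, …, δ_n`. -/
def pos {m n : ℕ} : Idx m n → ℕ := Sum.elim (fun i => (i : ℕ)) (fun j => m + (j : ℕ))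

/-- The underlying vector space of `gl(m,n)`. -/
abbrev Mat (k : Type*) (m n : ℕ) := Matrix (Idx m n) (Idx m n) k

/-- The homogeneous component of degree `a` of `gl(m,n)`: block diagonal matrices for `a = 0`,
block off-diagonal matrices for `a = 1`. -/
def homogeneous (k : Type*) [Field k] (m n : ℕ) (a : ZMod 2) : Submodule k (Mat k m n) where
  carrier := {x | ∀ i j, parity i + parity j ≠ a → x i j = 0}
  add_mem' := by
    intro x y hx hy i j h
    simp [hx i j h, hy i j h]
  zero_mem' := by
    intro i j _
    rfl
  smul_mem' := by
    intro c x hx i j h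
    simp [hx i j h]

/-- The sign `(-1)^(ab)`. -/
def sign (k : Type*) [Field k] (a b : ZMod 2) : k := if a = 1 ∧ b = 1 then -1 else 1

/-- The super bracket `[x,y] = xy - (-1)^(ab) yx` of `x` homogeneous of degree `a` and
`y` homogeneous of degree `b`. -/
def bracket {k : Type*} [Field k] {m n : ℕ} (a b : ZMod 2) (x y : Mat k m n) : Mat k m n :=
  x * y - sign k a b • (y * x)

/-- A Lie sub-superalgebra of `gl(m,n)`: a graded subspace closed under the super bracket. -/
structure SubSuperalgebra (k : Type*) [Field k] (m n : ℕ) where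
  carrier : Submodule k (Mat k m n)
  graded : carrier = ⨆ a : ZMod 2, carrier ⊓ homogeneous k m n a
  bracket_mem : ∀ (a b : ZMod 2) (x y : Mat k m n), x ∈ carrier → y ∈ carrier →
    x ∈ homogeneous k m n a → y ∈ homogeneous k m n b → bracket a b x y ∈ carrier

/-- The block diagonal part of a matrix. -/
def diagPart {k : Type*} [Field k] {m n : ℕ} : Mat k m n →ₗ[k] Mat k m n where
  toFun x := Matrix.of fun i j => if parity i = parity j then x i j else 0
  map_add' := by
    intro x y
    ext i j
    by_cases h : parity i = parity j <;> simp [h]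
  map_smul' := by
    intro c x
    ext i j
    by_cases h : parity i = parity j <;> simp [h]

theorem diagPart_apply {k : Type*} [Field k] {m n : ℕ} (x : Mat k m n) (i j : Idx m n) :
    diagPart x i j = if parity i = parity j then x i j else 0 := rfl

theorem diagPart_mem {k : Type*} [Field k] {m n : ℕ} (x : Mat k m n) :
    diagPart x ∈ homogeneous k m n 0 := by
  intro i j h
  rw [diagPart_apply, if_neg]
  intro e
  exact h (by rw [e]; exact CharTwo.add_self_eq_zero _)

theorem sub_diagPart_mem {k : Type*} [Field k] {m n : ℕ} (x : Mat k m n) :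
    x - diagPart x ∈ homogeneous k m n 1 := by
  rintro (i | i) (j | j) h <;> simp [diagPart_apply, parity] at h ⊢

/-- The graded decomposition of a subspace that contains the diagonal part of its elements. -/
theorem graded_of_diagPart {k : Type*} [Field k] {m n : ℕ} (S : Submodule k (Mat k m n))
    (h : ∀ x ∈ S, diagPart x ∈ S) : S = ⨆ a : ZMod 2, S ⊓ homogeneous k m n a := by
  apply le_antisymm
  · intro x hx
    have e : x = diagPart x + (x - diagPart x) := by abel
    rw [e]
    exact add_mem
      (Submodule.mem_iSup_of_mem 0 ⟨h x hx, diagPart_mem x⟩)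
      (Submodule.mem_iSup_of_mem 1 ⟨sub_mem hx (h x hx), sub_diagPart_mem x⟩)
  · exact iSup_le fun a => inf_le_left

/-- `𝔤 = gl(m,n)`. -/
def g (k : Type*) [Field k] (m n : ℕ) : SubSuperalgebra k m n where
  carrier := ⊤
  graded := graded_of_diagPart _ (fun _ _ => Submodule.mem_top)
  bracket_mem := fun _ _ _ _ _ _ _ _ => Submodule.mem_top

/-- `𝔭 = 𝔤₀ ⊕ 𝔤₁⁺`: the block upper triangular matrices. -/
def p (k : Type*) [Field k] (m n : ℕ) : SubSuperalgebra k m n where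
  carrier :=
    { carrier := {x | ∀ i j, x (Sum.inr i) (Sum.inl j) = 0}
      add_mem' := by
        intro x y hx hy i j
        simp [hx i j, hy i j]
      zero_mem' := by
        intro i j
        rfl
      smul_mem' := by
        intro c x hx i j
        simp [hx i j] }
  graded := by
    apply graded_of_diagPart
    intro x hx i j
    simp [diagPart_apply, parity]
  bracket_mem := by
    intro a b x y hx hy _ _ i j
    have hx' : ∀ i j, x (Sum.inr i) (Sum.inl j) = 0 := hx
    have hy' : ∀ i j, y (Sum.inr i) (Sum.inl j) = 0 := hy
    simp [bracket, Matrix.mul_apply, hx', hy']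

/-- `𝔤₀ = gl(m) × gl(n)`: the even part of `gl(m,n)`, the block diagonal matrices. -/
def g₀ (k : Type*) [Field k] (m n : ℕ) : SubSuperalgebra k m n where
  carrier := homogeneous k m n 0
  graded := graded_of_diagPart _ (fun x _ => diagPart_mem x)
  bracket_mem := by
    intro a b x y hx hy _ _
    have hx₁ : ∀ i j, x (Sum.inr i) (Sum.inl j) = 0 := fun i j => hx _ _ (by simp [parity])
    have hy₁ : ∀ i j, y (Sum.inr i) (Sum.inl j) = 0 := fun i j => hy _ _ (by simp [parity])
    have hx₂ : ∀ i j, x (Sum.inl i) (Sum.inr j) = 0 := fun i j => hx _ _ (by simp [parity])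
    have hy₂ : ∀ i j, y (Sum.inl i) (Sum.inr j) = 0 := fun i j => hy _ _ (by simp [parity])
    rintro (i | i) (j | j) h
    · simp [parity] at h
    · simp [bracket, Matrix.mul_apply, hx₂, hy₂]
    · simp [bracket, Matrix.mul_apply, hx₁, hy₁]
    · exact absurd (CharTwo.add_self_eq_zero _) h

/-! ### Enveloping algebras -/

/-- The defining relations `xy = (-1)^(ab) yx + [x,y]` of the enveloping algebra, for `x`, `y`
homogeneous of degrees `a`, `b`. -/
inductive Rel {k : Type*} [Field k] {m n : ℕ} (s : SubSuperalgebra k m n) :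
    TensorAlgebra k s.carrier → TensorAlgebra k s.carrier → Prop
  | comm (a b : ZMod 2) (x y : s.carrier) (hx : (x : Mat k m n) ∈ homogeneous k m n a)
      (hy : (y : Mat k m n) ∈ homogeneous k m n b) :
      Rel s (TensorAlgebra.ι k x * TensorAlgebra.ι k y)
        (sign k a b • (TensorAlgebra.ι k y * TensorAlgebra.ι k x) +
          TensorAlgebra.ι k
            (⟨bracket a b x y, s.bracket_mem a b x y x.2 y.2 hx hy⟩ : s.carrier))

/-- The universal enveloping algebra of a Lie sub-superalgebra of `gl(m,n)`. -/
def U {k : Type*} [Field k] {m n : ℕ} (s : SubSuperalgebra k m n) := RingQuot (Rel s)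

instance {k : Type*} [Field k] {m n : ℕ} (s : SubSuperalgebra k m n) : Ring (U s) :=
  inferInstanceAs (Ring (RingQuot (Rel s)))

instance {k : Type*} [Field k] {m n : ℕ} (s : SubSuperalgebra k m n) : Algebra k (U s) :=
  inferInstanceAs (Algebra k (RingQuot (Rel s)))

/-- The canonical map of a Lie superalgebra into its enveloping algebra. -/
def ι {k : Type*} [Field k] {m n : ℕ} (s : SubSuperalgebra k m n) : s.carrier →ₗ[k] U s :=
  (RingQuot.mkAlgHom k (Rel s)).toLinearMap.comp (TensorAlgebra.ι k)

theorem ι_mul_ι {k : Type*} [Field k] {m n : ℕ} (s : SubSuperalgebra k m n) (a b : ZMod 2)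
    (x y z : s.carrier) (hx : (x : Mat k m n) ∈ homogeneous k m n a)
    (hy : (y : Mat k m n) ∈ homogeneous k m n b) (hz : (z : Mat k m n) = bracket a b x y) :
    ι s x * ι s y = sign k a b • (ι s y * ι s x) + ι s z := by
  obtain rfl : z = ⟨bracket a b x y, s.bracket_mem a b x y x.2 y.2 hx hy⟩ := Subtype.ext hz
  have h := RingQuot.mkAlgHom_rel k (Rel.comm (s := s) a b x y hx hy)
  rw [map_mul, map_add, map_smul, map_mul] at h
  exact h

/-- The homomorphism of enveloping algebras that extends a homomorphism of Lie superalgebras. -/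
def mapU {k : Type*} [Field k] {m n : ℕ} {s t : SubSuperalgebra k m n}
    (f : s.carrier →ₗ[k] t.carrier)
    (hf : ∀ (a : ZMod 2) (x : s.carrier), (x : Mat k m n) ∈ homogeneous k m n a →
      (f x : Mat k m n) ∈ homogeneous k m n a)
    (hb : ∀ (a b : ZMod 2) (x y z : s.carrier), (x : Mat k m n) ∈ homogeneous k m n a →
      (y : Mat k m n) ∈ homogeneous k m n b → (z : Mat k m n) = bracket a b x y →
      (f z : Mat k m n) = bracket a b (f x : Mat k m n) (f y : Mat k m n)) :
    U s →ₐ[k] U t :=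
  RingQuot.liftAlgHom k ⟨TensorAlgebra.lift k ((ι t).comp f), by
    rintro _ _ ⟨a, b, x, y, hx, hy⟩
    simp only [map_mul, map_add, map_smul, TensorAlgebra.lift_ι_apply, LinearMap.comp_apply]
    exact ι_mul_ι t a b _ _ _ (hf a x hx) (hf b y hy) (hb a b x y _ hx hy rfl)⟩

/-- The homomorphism `U(𝔭) → U(𝔤)` induced by the inclusion. -/
def inclU (k : Type*) [Field k] (m n : ℕ) : U (p k m n) →ₐ[k] U (g k m n) :=
  mapU (LinearMap.codRestrict _ (p k m n).carrier.subtype (fun _ => Submodule.mem_top))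
    (fun _ _ hx => hx) (fun _ _ _ _ _ _ _ hz => hz)

theorem diagPart_mul {k : Type*} [Field k] {m n : ℕ} (x y : Mat k m n)
    (hx : ∀ i j, x (Sum.inr i) (Sum.inl j) = 0) (hy : ∀ i j, y (Sum.inr i) (Sum.inl j) = 0) :
    diagPart (x * y) = diagPart x * diagPart y := by
  ext (i | i) (j | j) <;> simp [diagPart_apply, Matrix.mul_apply, parity, hx, hy]

/-- The homomorphism `U(𝔭) → U(𝔤₀)` induced by the projection `𝔭 → 𝔤₀` with kernel `𝔤₁⁺`. -/
def projU (k : Type*) [Field k] (m n : ℕ) : U (p k m n) →ₐ[k] U (g₀ k m n) :=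
  mapU (LinearMap.codRestrict _ (diagPart.comp (p k m n).carrier.subtype)
      (fun x => diagPart_mem (x : Mat k m n)))
    (by
      intro a x hx i j h
      change diagPart (x : Mat k m n) i j = 0
      rw [diagPart_apply, hx i j h, ite_self])
    (by
      intro a b x y z _ _ hz
      change diagPart (z : Mat k m n) =
        bracket a b (diagPart (x : Mat k m n)) (diagPart (y : Mat k m n))
      rw [hz, bracket, bracket, map_sub, map_smul, diagPart_mul _ _ x.2 y.2,
        diagPart_mul _ _ y.2 x.2])

/-! ### Weights, the bilinear form, roots, dominance -/

/-- The dual of the Cartan subalgebra of diagonal matrices, in the basis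
`ε_1, …, ε_m, δ_1, …, δ_n`. -/
abbrev Weight (k : Type*) (m n : ℕ) := Idx m n → k

/-- The weight `ε_i`. -/
def ε {k : Type*} [Field k] {m n : ℕ} (i : Fin m) : Weight k m n := Pi.single (Sum.inl i) 1

/-- The weight `δ_j`. -/
def δ {k : Type*} [Field k] {m n : ℕ} (j : Fin n) : Weight k m n := Pi.single (Sum.inr j) 1

/-- The value `λ(h)` of the weight `λ` on the diagonal part `h` of the matrix `x`. -/
def evalDiag {k : Type*} [Field k] {m n : ℕ} (lam : Weight k m n) (x : Mat k m n) : k :=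
  ∑ i, lam i * x i i

/-- The invariant symmetric form on weights that comes from the supertrace:
`(ε_i, ε_j)` is `1` if `i = j` and `0` otherwise, `(δ_i, δ_j)` is `-1` if `i = j` and `0`
otherwise, and `(ε_i, δ_j) = 0`. -/
def form {k : Type*} [Field k] {m n : ℕ} (lam mu : Weight k m n) : k :=
  (∑ i : Fin m, lam (Sum.inl i) * mu (Sum.inl i)) -
    ∑ j : Fin n, lam (Sum.inr j) * mu (Sum.inr j)

/-- The root of the matrix unit `E_{ij}`, for `q = (i, j)`. -/
def root (k : Type*) [Field k] {m n : ℕ} (q : Idx m n × Idx m n) : Weight k m n :=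
  Pi.single q.1 1 - Pi.single q.2 1

/-- The pairs `(i, j)` for which `E_{ij}` is an even positive root vector
with respect to the Borel subalgebra of upper triangular matrices. -/
def evenPos (m n : ℕ) : Finset (Idx m n × Idx m n) :=
  Finset.univ.filter fun q => pos q.1 < pos q.2 ∧ parity q.1 = parity q.2

/-- The pairs `(i, j)` for which `E_{ij}` is an odd positive root vector
with respect to the Borel subalgebra of upper triangular matrices. -/
def oddPos (m n : ℕ) : Finset (Idx m n × Idx m n) :=
  Finset.univ.filter fun q => pos q.1 < pos q.2 ∧ parity q.1 ≠ parity q.2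

/-- `ρ = ρ₀ - ρ₁`, half the sum of the even positive roots minus half the sum of the odd
positive roots. -/
def rho (k : Type*) [Field k] (m n : ℕ) : Weight k m n :=
  (1 / 2 : k) • (∑ q ∈ evenPos m n, root k q) - (1 / 2 : k) • (∑ q ∈ oddPos m n, root k q)

/-- `α^∨ = 2α / (α, α)`. -/
def coroot {k : Type*} [Field k] {m n : ℕ} (α : Weight k m n) : Weight k m n :=
  (2 / form α α) • α

/-- The set `P⁺` of dominant weights: `(λ, α^∨)` is a nonnegative integer for every even
positive root `α`. -/
def IsDominant {k : Type*} [Field k] {m n : ℕ} (lam : Weight k m n) : Prop :=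
  ∀ q ∈ evenPos m n, ∃ N : ℕ, form lam (coroot (root k q)) = (N : k)

/-! ### Verma modules, simple highest weight modules, Kac modules -/

/-- The left ideal of `U(𝔰)` generated by the elements `x - λ(x)` for `x` in the Borel
subalgebra of upper triangular matrices in `𝔰`, where `λ` is extended by zero on strictly upper
triangular matrices. -/
def vermaIdeal {k : Type*} [Field k] {m n : ℕ} (s : SubSuperalgebra k m n)
    (lam : Weight k m n) : Submodule (U s) (U s) :=
  Submodule.span (U s)
    {u | ∃ x : s.carrier, (∀ i j, pos j < pos i → (x : Mat k m n) i j = 0) ∧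
      u = ι s x - algebraMap k (U s) (evalDiag lam (x : Mat k m n))}

/-- The Verma module of highest weight `λ`, that is the module induced from the one-dimensional
module of weight `λ` over the Borel subalgebra. The highest weight vector is the class of `1`. -/
abbrev Verma {k : Type*} [Field k] {m n : ℕ} (s : SubSuperalgebra k m n) (lam : Weight k m n) :=
  U s ⧸ vermaIdeal s lam

/-- The simple module of highest weight `λ`: the quotient of the Verma module by
the sum of all its proper submodules. -/
abbrev L {k : Type*} [Field k] {m n : ℕ} (s : SubSuperalgebra k m n) (lam : Weight k m n) :=
  Verma s lam ⧸ sSup {N : Submodule (U s) (Verma s lam) | N ≠ ⊤}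

/-- The simple `𝔤₀`-module `L⁰(λ)`, regarded as a `𝔭`-module on which `𝔤₁⁺` acts by zero. -/
def L₀ {k : Type*} [Field k] {m n : ℕ} (lam : Weight k m n) := L (g₀ k m n) lam

instance {k : Type*} [Field k] {m n : ℕ} (lam : Weight k m n) : AddCommGroup (L₀ lam) :=
  inferInstanceAs (AddCommGroup (L (g₀ k m n) lam))

instance {k : Type*} [Field k] {m n : ℕ} (lam : Weight k m n) : Module k (L₀ lam) :=
  inferInstanceAs (Module k (L (g₀ k m n) lam))

instance {k : Type*} [Field k] {m n : ℕ} (lam : Weight k m n) : Module (U (g₀ k m n)) (L₀ lam) :=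
  inferInstanceAs (Module (U (g₀ k m n)) (L (g₀ k m n) lam))

instance {k : Type*} [Field k] {m n : ℕ} (lam : Weight k m n) : Module (U (p k m n)) (L₀ lam) :=
  Module.compHom (L₀ lam) (projU k m n).toRingHom

/-- The relations `b φ(a) ⊗ v = b ⊗ a v` that define `B ⊗_A M` as a quotient of `B ⊗_k M`,
for a homomorphism `φ : A → B` of `k`-algebras and an `A`-module `M`. -/
def balanced {k A B : Type*} [Field k] [Ring A] [Algebra k A] [Ring B] [Algebra k B]
    (φ : A →ₐ[k] B) (M : Type*) [AddCommGroup M] [Module k M] [Module A M] :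
    Submodule B (B ⊗[k] M) :=
  Submodule.span B {t | ∃ (b : B) (a : A) (v : M), t = (b * φ a) ⊗ₜ[k] v - b ⊗ₜ[k] (a • v)}

/-- The induced module `B ⊗_A M`. -/
abbrev Induced {k A B : Type*} [Field k] [Ring A] [Algebra k A] [Ring B] [Algebra k B]
    (φ : A →ₐ[k] B) (M : Type*) [AddCommGroup M] [Module k M] [Module A M] :=
  (B ⊗[k] M) ⧸ balanced φ M

/-- The Kac module `K(λ) = U(𝔤) ⊗_{U(𝔭)} L⁰(λ)`. -/
abbrev KacModule {k : Type*} [Field k] {m n : ℕ} (lam : Weight k m n) :=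
  Induced (inclU k m n) (L₀ (k := k) (m := m) (n := n) lam)

/-! ### Composition multiplicities -/

/-- The multiplicity `[M : S]` of a simple module `S` as a composition factor of `M`: the largest
number of subquotients isomorphic to `S` in a finite strictly increasing chain of submodules
of `M`. If `M` has finite length, this is the number of factors isomorphic to `S` in any
composition series of `M`. -/
def multiplicity (R M S : Type*) [Ring R] [AddCommGroup M] [Module R M]
    [AddCommGroup S] [Module R S] : ℕ∞ :=
  ⨆ c : LTSeries (Submodule R M),
    Set.encard {i : Fin c.length |
      Nonempty ((↥(c i.succ) ⧸ (c i.castSucc).submoduleOf (c i.succ)) ≃ₗ[R] S)}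

end GLSuper

end

/-! Put μ = λ - ε_r + δ_s, let v be the highest weight vector of L⁰(λ), and write f_{ji} for the odd
lower matrix unit in row δ_j and column ε_i. The theorem holds because degree one of K(λ), the space
𝔤₋₁ ⊗ L⁰(λ), contains a vector w = ∑ f_{ji} ⊗ m_{ij} of weight μ killed by the even positive root
vectors. Applying the odd positive unit e_{ac} to w gives ∑_i E_{ai} m_{ic} + ∑_j E_{jc} m_{aj}, and
both sums are multiples of m_{ac}. The total scalar is (λ+ρ, ε_r - δ_s), so orthogonality is exactly
what makes w a highest weight vector for 𝔤.

The coefficients m_{ij} are explicit: lowering operators for gl(m) and gl(n) are applied to v,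
normalised so that m_{rs} = v (`lowOp`, `raise_lowOp`, `sum_univ_lowOp`). Their denominators are
positive integers because μ is dominant.

That w is nonzero is checked without a PBW theorem. An action of 𝔤 is built on Λ(𝔤₋₁) ⊗ L⁰(λ) by
recursion on the exterior degree (`exists_recursion`, `modelAct_mul`), and K(λ) maps to this model
by its universal property (`kacMap`). In the model the f_{sr}-coefficient of the image of w is v.
Only the image is shown to be a highest weight vector, and this suffices: an element u of U(𝔤) with
u w = 0 kills the image, hence kills the highest weight vector of L(μ), so the cyclic module U(𝔤) w
maps onto L(μ) (`mkQ_eq_zero_of_smul_eq_zero`, `multiplicity_ne_zero`). Injectivity of `kacMap`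
plays no role.

Two nondegeneracy facts remain. The sum of all proper submodules of a nonzero Verma module is
proper, by an eigenvalue argument for a grading element (`vermaVec_notMem_sSup`). The vector v is
nonzero, because the Verma module of 𝔤₀ maps nontrivially to a twisted polynomial representation
whose highest weight vector is a product of minors (`exists_polyHighestWeight`). -/

noncomputable section

namespace GLSuper

open scoped TensorProduct Polynomial

/-! ### Enveloping algebras: universal property and induction -/

section Enveloping

variable {k : Type*} [Field k] {m n : ℕ} {s : SubSuperalgebra k m n}

/-- The universal property of the enveloping algebra. -/
def liftU {A : Type*} [Ring A] [Algebra k A] (f : s.carrier →ₗ[k] A)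
    (hf : ∀ (a b : ZMod 2) (x y z : s.carrier), (x : Mat k m n) ∈ homogeneous k m n a →
      (y : Mat k m n) ∈ homogeneous k m n b → (z : Mat k m n) = bracket a b x y →
      f x * f y = sign k a b • (f y * f x) + f z) :
    U s →ₐ[k] A :=
  RingQuot.liftAlgHom k ⟨TensorAlgebra.lift k f, by
    rintro _ _ ⟨a, b, x, y, hx, hy⟩
    simp only [map_mul, map_add, map_smul, TensorAlgebra.lift_ι_apply]
    exact hf a b _ _ _ hx hy rfl⟩

@[simp]
theorem liftU_ι {A : Type*} [Ring A] [Algebra k A] (f : s.carrier →ₗ[k] A) (hf) (x : s.carrier) :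
    liftU f hf (ι s x) = f x := by
  simp only [liftU, ι]
  erw [RingQuot.liftAlgHom_mkAlgHom_apply]
  simp

@[simp]
theorem mapU_ι {t : SubSuperalgebra k m n} (f : s.carrier →ₗ[k] t.carrier) (hf) (hb)
    (x : s.carrier) : mapU f hf hb (ι s x) = ι t (f x) := by
  simp only [mapU, ι]
  erw [RingQuot.liftAlgHom_mkAlgHom_apply]
  simp
  rfl

/-- Induction on elements of the enveloping algebra. -/
theorem U_induction {P : U s → Prop} (algebraMap : ∀ c, P (algebraMap k (U s) c))
    (add : ∀ u v, P u → P v → P (u + v)) (mul : ∀ u v, P u → P v → P (u * v))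
    (ι : ∀ x, P (ι s x)) (u : U s) : P u := by
  obtain ⟨t, rfl⟩ := RingQuot.mkAlgHom_surjective k (Rel s) u
  induction t using TensorAlgebra.induction with
  | algebraMap c =>
    rw [AlgHom.commutes]
    exact algebraMap c
  | ι x => exact ι x
  | mul a b ha hb =>
    rw [map_mul]
    exact mul _ _ ha hb
  | add a b ha hb =>
    rw [map_add]
    exact add _ _ ha hb

/-- A subspace stable under the Lie superalgebra is stable under its enveloping algebra. -/
theorem U_smul_mem {N : Type*} [AddCommGroup N] [Module k N] [Module (U s) N]
    [IsScalarTower k (U s) N] (P : Submodule k N) (hP : ∀ x, ∀ w ∈ P, ι s x • w ∈ P)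
    (u : U s) : ∀ w ∈ P, u • w ∈ P := by
  induction u using U_induction with
  | algebraMap c =>
    intro w hw
    rw [algebraMap_smul]
    exact P.smul_mem c hw
  | add u v hu hv =>
    intro w hw
    rw [add_smul]
    exact add_mem (hu w hw) (hv w hw)
  | mul u v hu hv =>
    intro w hw
    rw [mul_smul]
    exact hu _ (hv w hw)
  | ι x => exact hP x

end Enveloping

/-! ### Matrix units -/

section Units

variable {k : Type*} [Field k] {m n : ℕ}

theorem single_mem_homogeneous (i j : Idx m n) (c : k) :
    Matrix.single i j c ∈ homogeneous k m n (parity i + parity j) := by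
  intro a b h
  rw [Matrix.single_apply, if_neg]
  rintro ⟨rfl, rfl⟩
  exact h rfl

/-- A sub-superalgebra that contains the matrix units occurring in its elements, and all
diagonal matrices. -/
structure IsRegular (s : SubSuperalgebra k m n) : Prop where
  single_mem : ∀ x ∈ s.carrier, ∀ i j, Matrix.single i j (x i j) ∈ s.carrier
  diag_mem : ∀ i, Matrix.single i i (1 : k) ∈ s.carrier

theorem isRegular_g : IsRegular (g k m n) :=
  ⟨fun _ _ _ _ => Submodule.mem_top, fun _ => Submodule.mem_top⟩

theorem isRegular_g₀ : IsRegular (g₀ k m n) := by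
  constructor
  · intro x hx i j a b h
    rw [Matrix.single_apply]
    split_ifs with e
    · obtain ⟨rfl, rfl⟩ := e
      exact hx _ _ h
    · rfl
  · intro i
    have := single_mem_homogeneous (k := k) i i 1
    rwa [CharTwo.add_self_eq_zero] at this

/-- Only units with a nonzero entry in `z` are tested, so a vanishing condition on `z`, such as
upper triangularity, passes to the units. -/
theorem IsRegular.mem_of_single_mem {s : SubSuperalgebra k m n} (hs : IsRegular s)
    (P : Submodule k s.carrier) (z : s.carrier)
    (hP : ∀ i j (h : Matrix.single i j (1 : k) ∈ s.carrier), (z : Mat k m n) i j ≠ 0 →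
      (⟨Matrix.single i j 1, h⟩ : s.carrier) ∈ P) : z ∈ P := by
  have e : z = ∑ i, ∑ j, (⟨_, hs.single_mem z z.2 i j⟩ : s.carrier) := by
    apply Subtype.ext
    simp only [Submodule.coe_sum]
    exact Matrix.matrix_eq_sum_single _
  rw [e]
  refine sum_mem fun i _ => sum_mem fun j _ => ?_
  by_cases h0 : (z : Mat k m n) i j = 0
  · convert P.zero_mem
    simp [h0]
  · have h1 : Matrix.single i j (1 : k) ∈ s.carrier := by
      have := s.carrier.smul_mem ((z : Mat k m n) i j)⁻¹ (hs.single_mem z z.2 i j)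
      rwa [Matrix.smul_single, smul_eq_mul, inv_mul_cancel₀ h0] at this
    convert P.smul_mem ((z : Mat k m n) i j) (hP i j h1 h0)
    simp

theorem evalDiag_single (mu : Weight k m n) (i j : Idx m n) :
    evalDiag mu (Matrix.single i j (1 : k)) = if i = j then mu i else 0 := by
  rw [evalDiag]
  split_ifs with h
  · subst h
    rw [Finset.sum_eq_single i] <;> simp +contextual [eq_comm]
  · refine Finset.sum_eq_zero fun a _ => ?_
    rw [Matrix.single_apply, if_neg, mul_zero]
    rintro ⟨rfl, rfl⟩
    exact h rfl

end Units

/-! ### Highest weight vectors -/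

section HighestWeight

variable {k : Type*} [Field k] {m n : ℕ} {s : SubSuperalgebra k m n}

/-- The upper triangular matrices act on `w` through the weight `μ`. -/
def IsHighestWeight (s : SubSuperalgebra k m n) (mu : Weight k m n) {N : Type*} [AddCommGroup N]
    [Module k N] [Module (U s) N] (w : N) : Prop :=
  ∀ x : s.carrier, (∀ i j, pos j < pos i → (x : Mat k m n) i j = 0) →
    ι s x • w = evalDiag mu (x : Mat k m n) • w

/-- The linear form `λ(h)`. -/
def evalDiagₗ (mu : Weight k m n) : Mat k m n →ₗ[k] k where
  toFun := evalDiag mu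
  map_add' x y := by simp [evalDiag, mul_add, Finset.sum_add_distrib]
  map_smul' c x := by simp [evalDiag, Finset.mul_sum, mul_add, mul_left_comm]

theorem isHighestWeight_of_single {N : Type*} [AddCommGroup N] [Module k N] [Module (U s) N]
    [IsScalarTower k (U s) N] (hs : IsRegular s) {mu : Weight k m n} {w : N}
    (hw : ∀ i j (h : Matrix.single i j (1 : k) ∈ s.carrier), pos i ≤ pos j →
      ι s ⟨_, h⟩ • w = if i = j then mu i • w else 0) : IsHighestWeight s mu w := by
  intro x hx
  let P : Submodule k s.carrier :=
    LinearMap.ker ((LinearMap.toSpanSingleton (U s) N w).restrictScalars k ∘ₗ ι s -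
      (LinearMap.toSpanSingleton k N w) ∘ₗ evalDiagₗ mu ∘ₗ s.carrier.subtype)
  have : x ∈ P := by
    refine hs.mem_of_single_mem P x fun i j h h0 => ?_
    have hp : pos i ≤ pos j := by
      by_contra! hlt
      exact h0 (hx _ _ hlt)
    change ι s ⟨_, h⟩ • w - evalDiag mu (Matrix.single i j (1 : k)) • w = 0
    rw [hw i j h hp, evalDiag_single, ite_smul, zero_smul, sub_self]
  exact sub_eq_zero.1 this

/-- The universal property of the Verma module: a highest weight vector of weight `mu` in any module
receives a map from it. -/
theorem vermaIdeal_le_ker {N : Type*} [AddCommGroup N] [Module k N] [Module (U s) N]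
    [IsScalarTower k (U s) N] {mu : Weight k m n} {w : N} (hw : IsHighestWeight s mu w) :
    vermaIdeal s mu ≤ LinearMap.ker (LinearMap.toSpanSingleton (U s) N w) := by
  rw [vermaIdeal, Submodule.span_le]
  rintro _ ⟨x, hx, rfl⟩
  simp only [SetLike.mem_coe, LinearMap.mem_ker, LinearMap.toSpanSingleton_apply, sub_smul,
    algebraMap_smul]
  rw [hw x hx, sub_self]

/-- The highest weight vector of the Verma module. -/
def vermaVec (s : SubSuperalgebra k m n) (mu : Weight k m n) : Verma s mu :=
  (vermaIdeal s mu).mkQ 1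

theorem mkQ_eq_smul_vermaVec (mu : Weight k m n) (u : U s) :
    (vermaIdeal s mu).mkQ u = u • vermaVec s mu := by
  rw [vermaVec, ← map_smul, smul_eq_mul, mul_one]

theorem isHighestWeight_vermaVec (mu : Weight k m n) :
    IsHighestWeight s mu (vermaVec s mu) := by
  intro x hx
  rw [← mkQ_eq_smul_vermaVec, vermaVec, ← sub_eq_zero]
  rw [← algebraMap_smul (U s) (evalDiag mu (x : Mat k m n)), ← map_smul, ← map_sub]
  rw [Submodule.mkQ_apply, Submodule.Quotient.mk_eq_zero]
  refine Submodule.subset_span ⟨x, hx, ?_⟩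
  simp

theorem eq_top_of_vermaVec_mem {mu : Weight k m n} {N : Submodule (U s) (Verma s mu)}
    (h : vermaVec s mu ∈ N) : N = ⊤ := by
  rw [eq_top_iff]
  intro x _
  obtain ⟨u, rfl⟩ := Submodule.mkQ_surjective _ x
  rw [mkQ_eq_smul_vermaVec]
  exact N.smul_mem u h

end HighestWeight

/-! ### The principal grading of a Verma module and its simple quotient -/

section Weights

variable {k : Type*} [Field k] {m n : ℕ} {s : SubSuperalgebra k m n}

/-- The diagonal matrix that defines the principal grading: its bracket with the matrix unit
`E_{ij}` is `pos j - pos i` times `E_{ij}`. -/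
def gradingElt (hs : IsRegular s) : s.carrier :=
  ∑ i, (-(pos i : k)) • ⟨Matrix.single i i 1, hs.diag_mem i⟩

theorem coe_gradingElt (hs : IsRegular s) :
    (gradingElt hs : Mat k m n) = Matrix.diagonal fun i => -(pos i : k) := by
  rw [gradingElt, Submodule.coe_sum, ← Matrix.sum_single_eq_diagonal]
  refine Finset.sum_congr rfl fun i _ => ?_
  rw [Submodule.coe_smul, Matrix.smul_single, smul_eq_mul, mul_one]

theorem gradingElt_mem (hs : IsRegular s) :
    (gradingElt hs : Mat k m n) ∈ homogeneous k m n 0 := by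
  rw [coe_gradingElt]
  intro i j h
  refine Matrix.diagonal_apply_ne _ ?_
  rintro rfl
  exact h (CharTwo.add_self_eq_zero _)

theorem gradingElt_mul_single (hs : IsRegular s) (i j : Idx m n)
    (h : Matrix.single i j (1 : k) ∈ s.carrier) :
    ι s (gradingElt hs) * ι s ⟨_, h⟩ =
      ι s ⟨_, h⟩ * ι s (gradingElt hs) + ((pos j : k) - pos i) • ι s ⟨_, h⟩ := by
  have := ι_mul_ι s 0 _ (gradingElt hs) ⟨_, h⟩ (((pos j : k) - pos i) • ⟨_, h⟩)
    (gradingElt_mem hs) (single_mem_homogeneous i j 1) (by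
      simp only [bracket, coe_gradingElt, sign, Submodule.coe_smul]
      ext a b
      by_cases e : i = a ∧ j = b
      · obtain ⟨rfl, rfl⟩ := e
        simp
        ring
      · simp [e])
  rw [this, map_smul]
  simp [sign]

theorem aeval_smul_of_smul_eq {N : Type*} [AddCommGroup N] [Module k N] [Module (U s) N]
    [IsScalarTower k (U s) N] {H : U s} {c : k} {v : N} (hv : H • v = c • v) (q : k[X]) :
    Polynomial.aeval H q • v = q.eval c • v := by
  have hc (c : k) (u : U s) (w : N) : u • c • w = c • u • w := by
    rw [← algebraMap_smul (U s) c w, ← mul_smul, ← Algebra.commutes, mul_smul, algebraMap_smul]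
  induction q using Polynomial.induction_on' with
  | add p q hp hq => rw [map_add, add_smul, hp, hq, Polynomial.eval_add, add_smul]
  | monomial d a =>
    rw [Polynomial.aeval_monomial, mul_smul, algebraMap_smul, Polynomial.eval_monomial, mul_smul]
    congr 1
    induction d with
    | zero => simp
    | succ d ih => rw [pow_succ, mul_smul, hv, hc, ih, smul_smul, pow_succ, mul_comm]

/-- The vectors annihilated by a polynomial in `H` that does not vanish at `c`. -/
def awayFrom (N : Type*) [AddCommGroup N] [Module k N] [Module (U s) N]
    [IsScalarTower k (U s) N] (H : U s) (c : k) : Submodule k N where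
  carrier := {u | ∃ q : k[X], q.eval c ≠ 0 ∧ Polynomial.aeval H q • u = 0}
  add_mem' := by
    rintro u v ⟨p, hp, hu⟩ ⟨q, hq, hv⟩
    -- Polynomials in `H` commute, so `p * q` kills both vectors; it does not vanish at `c` because
    -- neither factor does.
    refine ⟨p * q, by simp [hp, hq], ?_⟩
    rw [smul_add, map_mul, mul_smul _ _ v, hv, smul_zero, add_zero, ← map_mul, mul_comm, map_mul,
      mul_smul, hu, smul_zero]
  zero_mem' := ⟨1, by simp, by simp⟩
  smul_mem' := by
    rintro a u ⟨p, hp, hu⟩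
    refine ⟨p, hp, ?_⟩
    rw [← algebraMap_smul (U s) a u, ← mul_smul, ← Algebra.commutes, mul_smul, hu, smul_zero]

/-- The eigenspaces of `H`. -/
def eigen (N : Type*) [AddCommGroup N] [Module k N] [Module (U s) N]
    [IsScalarTower k (U s) N] (H : U s) (c : k) : Submodule k N where
  carrier := {u | H • u = c • u}
  add_mem' := by
    rintro u v (hu : _ = _) (hv : _ = _)
    change _ = _
    rw [smul_add, hu, hv, smul_add]
  zero_mem' := by simp
  smul_mem' := by
    rintro a u (hu : _ = _)
    change _ = _
    rw [← algebraMap_smul (U s) a u, ← mul_smul, ← Algebra.commutes, mul_smul, hu, algebraMap_smul,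
      algebraMap_smul, smul_comm]

theorem eigen_le_awayFrom (N : Type*) [AddCommGroup N] [Module k N] [Module (U s) N]
    [IsScalarTower k (U s) N] (H : U s) {c c' : k} (h : c ≠ c') :
    eigen N H c' ≤ awayFrom N H c := by
  intro u hu
  refine ⟨Polynomial.X - Polynomial.C c', by simpa [sub_eq_zero] using h, ?_⟩
  rw [aeval_smul_of_smul_eq hu]
  simp

/-- The filtration of the Verma module by the length of products of negative root vectors. -/
def vermaFilt (s : SubSuperalgebra k m n) (mu : Weight k m n) : ℕ → Submodule k (Verma s mu)
  | 0 => Submodule.span k {vermaVec s mu}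
  | p + 1 => vermaFilt s mu p ⊔ Submodule.span k {w | ∃ (i j : Idx m n)
      (h : Matrix.single i j (1 : k) ∈ s.carrier), pos j < pos i ∧ ∃ u ∈ vermaFilt s mu p,
        w = ι s ⟨_, h⟩ • u}

theorem vermaFilt_mono (mu : Weight k m n) (p : ℕ) :
    vermaFilt s mu p ≤ vermaFilt s mu (p + 1) := by
  rw [vermaFilt]
  exact le_sup_left

theorem smul_mem_vermaFilt_succ (mu : Weight k m n) (p : ℕ) {i j : Idx m n}
    (h : Matrix.single i j (1 : k) ∈ s.carrier) (hij : pos j < pos i) {u : Verma s mu}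
    (hu : u ∈ vermaFilt s mu p) : ι s ⟨_, h⟩ • u ∈ vermaFilt s mu (p + 1) := by
  rw [vermaFilt]
  exact Submodule.mem_sup_right (Submodule.subset_span ⟨i, j, h, hij, u, hu, rfl⟩)

/-- The action on a fixed vector. -/
def actOn {N : Type*} [AddCommGroup N] [Module k N] [Module (U s) N]
    [IsScalarTower k (U s) N] (w : N) : s.carrier →ₗ[k] N :=
  (LinearMap.toSpanSingleton (U s) N w).restrictScalars k ∘ₗ ι s

theorem actOn_apply {N : Type*} [AddCommGroup N] [Module k N] [Module (U s) N]
    [IsScalarTower k (U s) N] (w : N) (x : s.carrier) : actOn w x = ι s x • w := rfl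

/-- The action of a fixed element. -/
def actBy (N : Type*) [AddCommGroup N] [Module k N] [Module (U s) N]
    [IsScalarTower k (U s) N] (u : U s) : N →ₗ[k] N where
  toFun w := u • w
  map_add' := smul_add u
  map_smul' c w := by
    rw [RingHom.id_apply, ← algebraMap_smul (U s) c w, ← mul_smul, ← Algebra.commutes, mul_smul,
      algebraMap_smul]

theorem smul_mem_vermaFilt (hs : IsRegular s) (mu : Weight k m n) (p : ℕ) (z : s.carrier)
    {u : Verma s mu} (hu : u ∈ vermaFilt s mu p)
    (hup : ∀ i j (h : Matrix.single i j (1 : k) ∈ s.carrier), pos i ≤ pos j →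
      ι s ⟨_, h⟩ • u ∈ vermaFilt s mu p) : ι s z • u ∈ vermaFilt s mu (p + 1) := by
  refine hs.mem_of_single_mem ((vermaFilt s mu (p + 1)).comap (actOn u)) z fun i j h _ => ?_
  rw [Submodule.mem_comap, actOn_apply]
  rcases lt_or_ge (pos j) (pos i) with hlt | hle
  · exact smul_mem_vermaFilt_succ mu p h hlt hu
  · exact vermaFilt_mono mu p (hup i j h hle)

/-- An upper unit is moved past a lower one at the cost of their bracket. The bracket may be of any
triangularity, but it is applied to a vector one step further down the filtration, so the step it
may gain is harmless. -/
theorem upper_smul_mem_vermaFilt (hs : IsRegular s) (mu : Weight k m n) (p : ℕ) :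
    ∀ u ∈ vermaFilt s mu p, ∀ i j (h : Matrix.single i j (1 : k) ∈ s.carrier), pos i ≤ pos j →
      ι s ⟨_, h⟩ • u ∈ vermaFilt s mu p := by
  induction p with
  | zero =>
    intro u hu i j h hij
    rw [vermaFilt] at hu ⊢
    obtain ⟨c, rfl⟩ := Submodule.mem_span_singleton.1 hu
    change actBy (Verma s mu) (ι s ⟨_, h⟩) (c • vermaVec s mu) ∈ _
    rw [map_smul]
    refine Submodule.smul_mem _ _ ?_
    change ι s ⟨_, h⟩ • vermaVec s mu ∈ _
    rw [isHighestWeight_vermaVec mu ⟨_, h⟩]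
    · exact Submodule.smul_mem _ _ (Submodule.mem_span_singleton_self _)
    · intro a b hab
      refine Matrix.single_apply_of_ne _ _ _ _ _ ?_
      rintro ⟨rfl, rfl⟩
      omega
  | succ p ih =>
    intro u hu i j h hij
    suffices hle : vermaFilt s mu (p + 1) ≤
        (vermaFilt s mu (p + 1)).comap (actBy (Verma s mu) (ι s ⟨_, h⟩)) from hle hu
    conv_lhs => rw [vermaFilt]
    rw [sup_le_iff]
    constructor
    · intro w hw
      exact vermaFilt_mono mu p (ih w hw i j h hij)
    · rw [Submodule.span_le]
      rintro _ ⟨a, b, h', hab, w, hw, rfl⟩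
      change ι s ⟨_, h⟩ • ι s ⟨_, h'⟩ • w ∈ vermaFilt s mu (p + 1)
      rw [← mul_smul, ι_mul_ι s _ _ ⟨_, h⟩ ⟨_, h'⟩ ⟨_, s.bracket_mem _ _ _ _ h h'
        (single_mem_homogeneous i j 1) (single_mem_homogeneous a b 1)⟩
        (single_mem_homogeneous i j 1) (single_mem_homogeneous a b 1) rfl, add_smul, smul_assoc,
        mul_smul]
      refine add_mem (Submodule.smul_mem _ _ ?_) ?_
      · exact smul_mem_vermaFilt_succ mu p h' hab (ih w hw i j h hij)
      · exact smul_mem_vermaFilt hs mu p ⟨_, s.bracket_mem _ _ _ _ h h'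
          (single_mem_homogeneous i j 1) (single_mem_homogeneous a b 1)⟩ hw (ih w hw)

theorem iSup_vermaFilt (hs : IsRegular s) (mu : Weight k m n) : ⨆ p, vermaFilt s mu p = ⊤ := by
  have hst : ∀ x, ∀ w ∈ ⨆ p, vermaFilt s mu p, ι s x • w ∈ ⨆ p, vermaFilt s mu p := by
    intro x
    suffices hle : (⨆ p, vermaFilt s mu p) ≤
        (⨆ p, vermaFilt s mu p).comap (actBy (Verma s mu) (ι s x)) from fun w hw => hle hw
    refine iSup_le fun p w hw => ?_
    exact Submodule.mem_iSup_of_mem (p + 1)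
      (smul_mem_vermaFilt hs mu p x hw (upper_smul_mem_vermaFilt hs mu p w hw))
  rw [eq_top_iff]
  intro w _
  obtain ⟨u, rfl⟩ := Submodule.mkQ_surjective _ w
  rw [mkQ_eq_smul_vermaVec]
  refine U_smul_mem _ hst u _ (Submodule.mem_iSup_of_mem 0 ?_)
  rw [vermaFilt]
  exact Submodule.mem_span_singleton_self _

theorem gradingElt_smul_vermaVec (hs : IsRegular s) (mu : Weight k m n) :
    ι s (gradingElt hs) • vermaVec s mu =
      evalDiag mu (gradingElt hs : Mat k m n) • vermaVec s mu := by
  refine isHighestWeight_vermaVec mu _ fun i j hij => ?_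
  rw [coe_gradingElt]
  refine Matrix.diagonal_apply_ne _ ?_
  rintro rfl
  omega

theorem vermaFilt_le (hs : IsRegular s) (mu : Weight k m n) (p : ℕ) :
    vermaFilt s mu p ≤ Submodule.span k {vermaVec s mu} ⊔ ⨆ d : ℕ, eigen (Verma s mu)
      (ι s (gradingElt hs)) (evalDiag mu (gradingElt hs : Mat k m n) - (d + 1 : ℕ)) := by
  have key (i j : Idx m n) (h : Matrix.single i j (1 : k) ∈ s.carrier) (c : k)
      (w : Verma s mu) (hw : ι s (gradingElt hs) • w = c • w) :
      ι s ⟨_, h⟩ • w ∈ eigen (Verma s mu) (ι s (gradingElt hs)) (c + ((pos j : k) - pos i)) := by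
    change _ = _
    rw [← mul_smul, gradingElt_mul_single, add_smul, mul_smul, hw, add_smul, smul_assoc]
    congr 1
    exact (actBy (Verma s mu) (ι s ⟨_, h⟩)).map_smul c w
  induction p with
  | zero =>
    rw [vermaFilt]
    exact le_sup_left
  | succ p ih =>
    rw [vermaFilt, sup_le_iff]
    refine ⟨ih, Submodule.span_le.2 ?_⟩
    rintro _ ⟨i, j, h, hij, w, hw, rfl⟩
    refine Submodule.mem_sup_right ?_
    suffices hle : _ ≤ (⨆ d : ℕ, eigen (Verma s mu) (ι s (gradingElt hs))
      (evalDiag mu (gradingElt hs : Mat k m n) - (d + 1 : ℕ))).comap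
        (actBy (Verma s mu) (ι s ⟨_, h⟩)) from hle (ih hw)
    -- Here `pos i = pos j + e + 1`, so `E_{ij}` lowers the eigenvalue by `e + 1`: the generator
    -- goes to index `e`, and index `d` to `d + e + 1`.
    obtain ⟨e, he⟩ := Nat.exists_eq_add_of_lt hij
    rw [sup_le_iff]
    constructor
    · rw [Submodule.span_singleton_le_iff_mem]
      refine Submodule.mem_iSup_of_mem e ?_
      have := key i j h _ _ (gradingElt_smul_vermaVec hs mu)
      rw [he] at this
      change ι s ⟨_, h⟩ • vermaVec s mu ∈ eigen _ _ _
      convert this using 2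
      push_cast
      ring
    · refine iSup_le fun d w hw => Submodule.mem_iSup_of_mem (d + e + 1) ?_
      have := key i j h _ _ hw
      rw [he] at this
      change ι s ⟨_, h⟩ • w ∈ eigen _ _ _
      convert this using 2
      push_cast
      ring

/-- `awayFrom` replaces the sum of the lower weight spaces. In characteristic zero a strictly
lowered eigenvalue differs from the top one, so everything except the line of the generator lies in
it. -/
theorem span_sup_awayFrom [CharZero k] (hs : IsRegular s) (mu : Weight k m n) :
    Submodule.span k {vermaVec s mu} ⊔ awayFrom (Verma s mu) (ι s (gradingElt hs))
      (evalDiag mu (gradingElt hs : Mat k m n)) = ⊤ := by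
  rw [eq_top_iff, ← iSup_vermaFilt hs mu]
  refine iSup_le fun p => (vermaFilt_le hs mu p).trans (sup_le_sup_left (iSup_le fun d => ?_) _)
  refine eigen_le_awayFrom _ _ ?_
  intro h
  rw [eq_comm, sub_eq_self, Nat.cast_eq_zero] at h
  omega

/-- Write an element of `N` as `c v + t` with `q(H) t = 0` and `q` nonzero at the top eigenvalue.
Applying `q(H)` leaves a multiple of the generator `v` in `N`, a nonzero one if `c ≠ 0`, which would
force `N = ⊤`. -/
theorem le_awayFrom [CharZero k] (hs : IsRegular s) (mu : Weight k m n) {N : Submodule (U s) (Verma s mu)}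
    (hN : N ≠ ⊤) : N.restrictScalars k ≤ awayFrom (Verma s mu) (ι s (gradingElt hs))
      (evalDiag mu (gradingElt hs : Mat k m n)) := by
  intro u hu
  have hmem : u ∈ Submodule.span k {vermaVec s mu} ⊔ awayFrom (Verma s mu) (ι s (gradingElt hs))
      (evalDiag mu (gradingElt hs : Mat k m n)) := by
    rw [span_sup_awayFrom]
    trivial
  obtain ⟨v, hv, t, ⟨q, hq, ht⟩, rfl⟩ := Submodule.mem_sup.1 hmem
  obtain ⟨c, rfl⟩ := Submodule.mem_span_singleton.1 hv
  by_cases hc : c = 0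
  · subst hc
    rw [zero_smul, zero_add]
    exact ⟨q, hq, ht⟩
  · exfalso
    have h1 : Polynomial.aeval (ι s (gradingElt hs)) q • (c • vermaVec s mu + t) ∈ N :=
      N.smul_mem _ hu
    have h2 := (actBy (Verma s mu) (Polynomial.aeval (ι s (gradingElt hs)) q)).map_smul c
      (vermaVec s mu)
    change Polynomial.aeval (ι s (gradingElt hs)) q • c • vermaVec s mu =
      c • Polynomial.aeval (ι s (gradingElt hs)) q • vermaVec s mu at h2
    rw [smul_add, ht, add_zero, h2, aeval_smul_of_smul_eq (gradingElt_smul_vermaVec hs mu),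
      smul_smul] at h1
    have h3 := (N.restrictScalars k).smul_mem
      (c * q.eval (evalDiag mu (gradingElt hs : Mat k m n)))⁻¹ h1
    rw [smul_smul, inv_mul_cancel₀ (mul_ne_zero hc hq), one_smul] at h3
    exact hN (eq_top_of_vermaVec_mem h3)

/-- The single subspace `awayFrom` contains every proper submodule, hence their sum, while a
polynomial in the grading element acts on the generator by its value at the top eigenvalue. -/
theorem vermaVec_notMem_sSup [CharZero k] (hs : IsRegular s) (mu : Weight k m n) (h0 : vermaVec s mu ≠ 0) :
    vermaVec s mu ∉ sSup {N : Submodule (U s) (Verma s mu) | N ≠ ⊤} := by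
  intro hmem
  obtain ⟨q, hq, ht⟩ : vermaVec s mu ∈ awayFrom (Verma s mu) (ι s (gradingElt hs))
      (evalDiag mu (gradingElt hs : Mat k m n)) := by
    rw [sSup_eq_iSup'] at hmem
    generalize vermaVec s mu = v at hmem
    induction hmem using Submodule.iSup_induction' with
    | mem N x hx => exact le_awayFrom hs mu N.2 hx
    | zero => exact zero_mem _
    | add x y _ _ hx hy => exact add_mem hx hy
  rw [aeval_smul_of_smul_eq (gradingElt_smul_vermaVec hs mu)] at ht
  exact (smul_ne_zero hq h0) ht

theorem isCoatom_sSup [CharZero k] (hs : IsRegular s) (mu : Weight k m n) (h0 : vermaVec s mu ≠ 0) :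
    IsCoatom (sSup {N : Submodule (U s) (Verma s mu) | N ≠ ⊤}) := by
  constructor
  · intro h
    refine vermaVec_notMem_sSup hs mu h0 ?_
    rw [h]
    trivial
  · intro N hN
    by_contra hne
    exact hN.not_ge (le_sSup hne)

variable {N : Type*} [AddCommGroup N] [Module k N] [Module (U s) N] [IsScalarTower k (U s) N]

/-- The annihilator of a nonzero highest weight vector annihilates the highest weight vector of
the simple module. -/
theorem mkQ_eq_zero_of_smul_eq_zero {mu : Weight k m n} {w : N}
    (hw : IsHighestWeight s mu w) (h0 : w ≠ 0) {u : U s} (hu : u • w = 0) :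
    (sSup {N : Submodule (U s) (Verma s mu) | N ≠ ⊤}).mkQ ((vermaIdeal s mu).mkQ u) = 0 := by
  let f : Verma s mu →ₗ[U s] N :=
    (vermaIdeal s mu).liftQ (LinearMap.toSpanSingleton (U s) N w) (vermaIdeal_le_ker hw)
  rw [← LinearMap.mem_ker, Submodule.ker_mkQ]
  refine Submodule.mem_sSup_of_mem (s := LinearMap.ker f) ?_ ?_
  · intro h
    have : f (vermaVec s mu) = 0 := by
      rw [← LinearMap.mem_ker, h]
      trivial
    apply h0
    simpa [f, vermaVec] using this
  · simpa [f] using hu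

theorem vermaVec_ne_zero {mu : Weight k m n} {w : N}
    (hw : IsHighestWeight s mu w) (h0 : w ≠ 0) : vermaVec s mu ≠ 0 := by
  intro h
  rw [vermaVec, ← LinearMap.mem_ker, Submodule.ker_mkQ] at h
  have := vermaIdeal_le_ker hw h
  simp [h0] at this

theorem isSimpleModule_L [CharZero k] (hs : IsRegular s) {mu : Weight k m n} {w : N}
    (hw : IsHighestWeight s mu w) (h0 : w ≠ 0) : IsSimpleModule (U s) (L s mu) :=
  isSimpleModule_iff_isCoatom.2 (isCoatom_sSup hs mu (vermaVec_ne_zero hw h0))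

end Weights

/-! ### The exterior model of a Kac module -/

section Recursion

variable {k V M : Type*} [Field k] [AddCommGroup V] [Module k V] [AddCommGroup M] [Module k M]

/-- The space `Λ(V) ⊗ M`. -/
def ExtTensor (k V M : Type*) [Field k] [AddCommGroup V] [Module k V] [AddCommGroup M]
    [Module k M] := ExteriorAlgebra k V ⊗[k] M

instance : AddCommGroup (ExtTensor k V M) :=
  inferInstanceAs (AddCommGroup (ExteriorAlgebra k V ⊗[k] M))

instance : Module k (ExtTensor k V M) :=
  inferInstanceAs (Module k (ExteriorAlgebra k V ⊗[k] M))

/-- The pure tensors of `Λ(V) ⊗ M`. -/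
def ExtTensor.mk (k V M : Type*) [Field k] [AddCommGroup V] [Module k V] [AddCommGroup M]
    [Module k M] : ExteriorAlgebra k V →ₗ[k] M →ₗ[k] ExtTensor k V M :=
  TensorProduct.mk k _ M

/-- Maps out of `Λ(V) ⊗ M`. -/
def ExtTensor.lift {N : Type*} [AddCommGroup N] [Module k N]
    (f : ExteriorAlgebra k V →ₗ[k] M →ₗ[k] N) : ExtTensor k V M →ₗ[k] N :=
  TensorProduct.lift f

@[simp]
theorem ExtTensor.lift_mk {N : Type*} [AddCommGroup N] [Module k N]
    (f : ExteriorAlgebra k V →ₗ[k] M →ₗ[k] N) (a : ExteriorAlgebra k V) (v : M) :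
    ExtTensor.lift f (ExtTensor.mk k V M a v) = f a v :=
  TensorProduct.lift.tmul a v

theorem ExtTensor.hom_ext {N : Type*} [AddCommGroup N] [Module k N]
    {f g : ExtTensor k V M →ₗ[k] N}
    (h : ∀ a v, f (ExtTensor.mk k V M a v) = g (ExtTensor.mk k V M a v)) : f = g :=
  TensorProduct.ext' h

/-- Left exterior multiplication on `Λ(V) ⊗ M`. -/
def extMul (M : Type*) [AddCommGroup M] [Module k M] :
    V →ₗ[k] Module.End k (ExtTensor k V M) where
  toFun f := ExtTensor.lift (ExtTensor.mk k V M ∘ₗ LinearMap.mulLeft k (ExteriorAlgebra.ι k f))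
  map_add' f f' := by
    refine ExtTensor.hom_ext fun a v => ?_
    simp [add_mul]
  map_smul' c f := by
    refine ExtTensor.hom_ext fun a v => ?_
    simp

@[simp]
theorem extMul_mk (f : V) (a : ExteriorAlgebra k V) (v : M) :
    extMul M f (ExtTensor.mk k V M a v) = ExtTensor.mk k V M (ExteriorAlgebra.ι k f * a) v := by
  simp [extMul]

theorem extMul_mul_self (f : V) : extMul (k := k) M f * extMul M f = 0 := by
  refine ExtTensor.hom_ext fun a v => ?_
  rw [Module.End.mul_apply, extMul_mk, extMul_mk, ← mul_assoc, ExteriorAlgebra.ι_sq_zero,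
    zero_mul, map_zero, LinearMap.zero_apply, LinearMap.zero_apply]

theorem extMul_mul_add (f f' : V) :
    extMul (k := k) M f * extMul M f' + extMul M f' * extMul M f = 0 := by
  have h := extMul_mul_self (k := k) (M := M) (f + f')
  rw [map_add, add_mul, mul_add, mul_add, extMul_mul_self, extMul_mul_self] at h
  rw [← h]
  abel

/-- The step of the recursion that defines an operator on `Λ(V) ⊗ M` from its commutation
relations with exterior multiplications. -/
def recStep (S : V →ₗ[k] Module.End k (ExtTensor k V M)) (c : k) :
    V →ₗ[k] ExteriorAlgebra k V × (M →ₗ[k] ExtTensor k V M) →ₗ[k]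
      (M →ₗ[k] ExtTensor k V M) :=
  LinearMap.mk₂ k (fun f q => S f ∘ₗ ExtTensor.mk k V M q.1 + c • (extMul M f ∘ₗ q.2))
    (by intro f f' q; ext v; simp; abel)
    (by intro a f q; ext v; simp [smul_comm c])
    (by intro f q q'; ext v; simp; abel)
    (by intro a f q; ext v; simp [smul_comm c])

/-- The operator is forced by `T (f ∧ a ⊗ v) = S f (a ⊗ v) + c f ∧ T (a ⊗ v)`. The only obstruction
is `f ∧ f = 0`, and `hS` is precisely that consistency condition. Since `S f` is applied to the tail
itself and not only to its image, the fold over the Clifford algebra of the zero form carries the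
pair of both. -/
theorem exists_recursion (S : V →ₗ[k] Module.End k (ExtTensor k V M)) (c : k)
    (hS : ∀ f, S f * extMul M f + c • (extMul M f * S f) = 0)
    (T₀ : M →ₗ[k] ExtTensor k V M) :
    ∃ T : Module.End k (ExtTensor k V M),
      (∀ f, T * extMul M f = S f + c • (extMul M f * T)) ∧
        ∀ v, T (ExtTensor.mk k V M 1 v) = T₀ v := by
  have hf : ∀ f x fx, recStep S c f (CliffordAlgebra.ι (0 : QuadraticForm k V) f * x,
      recStep S c f (x, fx)) = (0 : QuadraticForm k V) f • fx := by
    intro f x fx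
    ext v
    have h1 := LinearMap.congr_fun (hS f) (ExtTensor.mk k V M x v)
    have h2 := LinearMap.congr_fun (extMul_mul_self (k := k) (M := M) f) (fx v)
    simp only [LinearMap.add_apply, Module.End.mul_apply, LinearMap.smul_apply, extMul_mk,
      LinearMap.zero_apply] at h1 h2
    simp only [recStep, LinearMap.mk₂_apply, LinearMap.add_apply, LinearMap.comp_apply,
      LinearMap.smul_apply, map_add, map_smul, h2, smul_zero, add_zero,
      zero_apply, zero_smul, LinearMap.zero_apply]
    exact h1
  refine ⟨ExtTensor.lift (CliffordAlgebra.foldr' (0 : QuadraticForm k V) (recStep S c) hf T₀),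
    fun f => ExtTensor.hom_ext fun x v => ?_, fun v => ?_⟩
  · rw [Module.End.mul_apply, extMul_mk, ExtTensor.lift_mk]
    erw [CliffordAlgebra.foldr'_ι_mul]
    simp [recStep]
  · rw [ExtTensor.lift_mk]
    have := CliffordAlgebra.foldr'_algebraMap (0 : QuadraticForm k V) (recStep S c) hf T₀ 1
    rw [map_one, one_smul] at this
    exact LinearMap.congr_fun this v

/-- This is how relations between operators on the model are verified: the defect of a relation
commutes or anticommutes with exterior multiplications, so it vanishes once it vanishes on the
bottom component. -/
theorem eq_zero_of_recursion {T : Module.End k (ExtTensor k V M)} (c : k)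
    (h : ∀ f, T * extMul M f = c • (extMul M f * T))
    (h1 : ∀ v, T (ExtTensor.mk k V M 1 v) = 0) : T = 0 := by
  refine ExtTensor.hom_ext fun x v => ?_
  rw [LinearMap.zero_apply]
  induction x using CliffordAlgebra.left_induction with
  | algebraMap a =>
    rw [Algebra.algebraMap_eq_smul_one]
    have := congrArg (a • ·) (h1 v)
    simp only [smul_zero] at this
    rw [← map_smul, ← LinearMap.smul_apply, ← map_smul] at this
    exact this
  | add x y hx hy => rw [map_add, LinearMap.add_apply, map_add, hx, hy, add_zero]
  | ι_mul x f hx =>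
    have := LinearMap.congr_fun (h f) (ExtTensor.mk k V M x v)
    rw [Module.End.mul_apply, LinearMap.smul_apply, Module.End.mul_apply, hx, map_zero,
      smul_zero, extMul_mk] at this
    exact this

theorem eq_of_recursion {T T' : Module.End k (ExtTensor k V M)} (c : k)
    {S : V → Module.End k (ExtTensor k V M)}
    (h : ∀ f, T * extMul M f = S f + c • (extMul M f * T))
    (h' : ∀ f, T' * extMul M f = S f + c • (extMul M f * T'))
    (h1 : ∀ v, T (ExtTensor.mk k V M 1 v) = T' (ExtTensor.mk k V M 1 v)) : T = T' := by
  refine sub_eq_zero.1 (eq_zero_of_recursion c (fun f => ?_) fun v => ?_)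
  · rw [sub_mul, h, h', mul_sub, smul_sub]
    abel
  · rw [LinearMap.sub_apply, h1, sub_self]

end Recursion

/-! ### The action of `gl(m,n)` on the exterior model -/

section Model

variable {k : Type*} [Field k] {m n : ℕ} {M : Type*} [AddCommGroup M] [Module k M]

/-- The block diagonal matrices, as a ring. -/
abbrev Even (k : Type*) [Field k] (m n : ℕ) :=
  Matrix (Fin m) (Fin m) k × Matrix (Fin n) (Fin n) k

/-- The lower left blocks. -/
abbrev Low (k : Type*) (m n : ℕ) := Matrix (Fin n) (Fin m) k

/-- The upper right blocks. -/
abbrev Upp (k : Type*) (m n : ℕ) := Matrix (Fin m) (Fin n) k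

/-- The underlying space of the model. -/
abbrev Model (k : Type*) [Field k] (m n : ℕ) (M : Type*) [AddCommGroup M] [Module k M] :=
  ExtTensor k (Low k m n) M

/-- The bracket of an even matrix and a lower left block. -/
def evenLow : Even k m n →ₗ[k] Low k m n →ₗ[k] Low k m n :=
  LinearMap.mk₂ k (fun x f => x.2 * f - f * x.1)
    (by intros; simp [Matrix.add_mul, Matrix.mul_add]; abel)
    (by intros; simp [smul_sub])
    (by intros; simp [Matrix.add_mul, Matrix.mul_add]; abel)
    (by intros; simp [smul_sub])

/-- The bracket of an upper right block and a lower left block. -/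
def uppLow : Upp k m n →ₗ[k] Low k m n →ₗ[k] Even k m n :=
  LinearMap.mk₂ k (fun e f => (e * f, f * e))
    (by intros; simp [Matrix.add_mul, Matrix.mul_add])
    (by intros; simp)
    (by intros; simp [Matrix.add_mul, Matrix.mul_add])
    (by intros; simp)

theorem evenLow_apply (x : Even k m n) (f : Low k m n) : evenLow x f = x.2 * f - f * x.1 := rfl

theorem uppLow_apply (e : Upp k m n) (f : Low k m n) : uppLow e f = (e * f, f * e) := rfl

variable (ρ : Even k m n →ₗ[k] Module.End k M)

theorem exists_evenAct (x : Even k m n) : ∃ T : Module.End k (Model k m n M),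
    (∀ f, T * extMul M f = extMul M (evenLow x f) + (1 : k) • (extMul M f * T)) ∧
      ∀ v, T (ExtTensor.mk k _ M 1 v) = ExtTensor.mk k _ M 1 (ρ x v) := by
  refine exists_recursion (extMul M ∘ₗ evenLow x) 1 (fun f => ?_) (ExtTensor.mk k _ M 1 ∘ₗ ρ x)
  rw [one_smul, LinearMap.comp_apply, extMul_mul_add]

/-- The action of even matrices on the model. -/
def evenAct : Even k m n →ₗ[k] Module.End k (Model k m n M) where
  toFun x := (exists_evenAct ρ x).choose
  map_add' x y := by
    refine eq_of_recursion (1 : k) (exists_evenAct ρ (x + y)).choose_spec.1 (fun f => ?_)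
      fun v => ?_
    · rw [add_mul, (exists_evenAct ρ x).choose_spec.1, (exists_evenAct ρ y).choose_spec.1, mul_add,
        map_add, LinearMap.add_apply, map_add, smul_add]
      abel
    · rw [(exists_evenAct ρ (x + y)).choose_spec.2, LinearMap.add_apply,
        (exists_evenAct ρ x).choose_spec.2, (exists_evenAct ρ y).choose_spec.2, map_add,
        LinearMap.add_apply, map_add]
  map_smul' c x := by
    refine eq_of_recursion (1 : k) (exists_evenAct ρ (c • x)).choose_spec.1 (fun f => ?_)
      fun v => ?_
    · rw [RingHom.id_apply, smul_mul_assoc, (exists_evenAct ρ x).choose_spec.1, map_smul,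
        LinearMap.smul_apply, map_smul, smul_add, one_smul, one_smul, mul_smul_comm]
    · rw [(exists_evenAct ρ (c • x)).choose_spec.2, RingHom.id_apply, LinearMap.smul_apply,
        (exists_evenAct ρ x).choose_spec.2, map_smul, LinearMap.smul_apply, map_smul]

theorem evenAct_mul_extMul (x : Even k m n) (f : Low k m n) :
    evenAct ρ x * extMul M f = extMul M (evenLow x f) + extMul M f * evenAct ρ x := by
  have := (exists_evenAct ρ x).choose_spec.1 f
  rwa [one_smul] at this

theorem evenAct_one_tmul (x : Even k m n) (v : M) : 
    evenAct ρ x (ExtTensor.mk k _ M 1 v) = ExtTensor.mk k _ M 1 (ρ x v) :=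
  (exists_evenAct ρ x).choose_spec.2 v

/-- The identity `[[e,f],f] = 0` is the consistency condition for the recursion that defines the
action of `e`. -/
theorem evenLow_uppLow_self (e : Upp k m n) (f : Low k m n) : evenLow (uppLow e f) f = 0 := by
  rw [evenLow_apply, uppLow_apply, Matrix.mul_assoc, sub_self]

theorem exists_uppAct (e : Upp k m n) : ∃ T : Module.End k (Model k m n M),
    (∀ f, T * extMul M f = evenAct ρ (uppLow e f) + (-1 : k) • (extMul M f * T)) ∧
      ∀ v, T (ExtTensor.mk k _ M 1 v) = 0 := by
  refine exists_recursion (evenAct ρ ∘ₗ uppLow e) (-1) (fun f => ?_) 0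
  rw [LinearMap.comp_apply, evenAct_mul_extMul, evenLow_uppLow_self, map_zero, zero_add,
    neg_one_smul, add_neg_cancel]

/-- The action of the upper right blocks on the model. -/
def uppAct : Upp k m n →ₗ[k] Module.End k (Model k m n M) where
  toFun e := (exists_uppAct ρ e).choose
  map_add' x y := by
    refine eq_of_recursion (-1 : k) (exists_uppAct ρ (x + y)).choose_spec.1 (fun f => ?_)
      fun v => ?_
    · rw [add_mul, (exists_uppAct ρ x).choose_spec.1, (exists_uppAct ρ y).choose_spec.1, mul_add,
        map_add, LinearMap.add_apply, map_add, smul_add]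
      abel
    · rw [(exists_uppAct ρ (x + y)).choose_spec.2, LinearMap.add_apply,
        (exists_uppAct ρ x).choose_spec.2, (exists_uppAct ρ y).choose_spec.2, add_zero]
  map_smul' c x := by
    refine eq_of_recursion (-1 : k) (exists_uppAct ρ (c • x)).choose_spec.1 (fun f => ?_)
      fun v => ?_
    · rw [RingHom.id_apply, smul_mul_assoc, (exists_uppAct ρ x).choose_spec.1, map_smul,
        LinearMap.smul_apply, map_smul, smul_add, mul_smul_comm, smul_comm c]
    · rw [(exists_uppAct ρ (c • x)).choose_spec.2, RingHom.id_apply, LinearMap.smul_apply,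
        (exists_uppAct ρ x).choose_spec.2, smul_zero]

theorem uppAct_mul_extMul (e : Upp k m n) (f : Low k m n) :
    uppAct ρ e * extMul M f = evenAct ρ (uppLow e f) - extMul M f * uppAct ρ e := by
  have := (exists_uppAct ρ e).choose_spec.1 f
  rwa [neg_one_smul, ← sub_eq_add_neg] at this

theorem uppAct_one_tmul (e : Upp k m n) (v : M) : uppAct ρ e (ExtTensor.mk k _ M 1 v) = 0 :=
  (exists_uppAct ρ e).choose_spec.2 v

variable (hρ : ∀ x y, ρ x * ρ y - ρ y * ρ x = ρ (x * y - y * x))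

include hρ

theorem evenAct_commutator (x y : Even k m n) :
    evenAct ρ x * evenAct ρ y - evenAct ρ y * evenAct ρ x = evenAct ρ (x * y - y * x) := by
  rw [← sub_eq_zero]
  refine eq_zero_of_recursion (1 : k) (fun f => ?_) fun v => ?_
  · have h1 := evenAct_mul_extMul ρ x f
    have h2 := evenAct_mul_extMul ρ y f
    have h3 := evenAct_mul_extMul ρ x (evenLow y f)
    have h4 := evenAct_mul_extMul ρ y (evenLow x f)
    have h5 := evenAct_mul_extMul ρ (x * y - y * x) f
    have h6 : evenLow (x * y - y * x) f = evenLow x (evenLow y f) - evenLow y (evenLow x f) := by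
      simp only [evenLow_apply, Prod.fst_sub, Prod.snd_sub, Prod.fst_mul, Prod.snd_mul,
        Matrix.sub_mul, Matrix.mul_sub, Matrix.mul_assoc]
      abel
    rw [h6, map_sub (extMul M)] at h5
    rw [one_smul]
    generalize x * y - y * x = z at h5 ⊢
    linear_combination (norm := noncomm_ring) evenAct ρ x * h2 + h1 * evenAct ρ y + h3 -
      (evenAct ρ y * h1 + h2 * evenAct ρ x + h4) - h5
  · rw [LinearMap.sub_apply, LinearMap.sub_apply, Module.End.mul_apply, Module.End.mul_apply]
    simp only [evenAct_one_tmul]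
    rw [← hρ x y, ← map_sub, ← map_sub]
    exact (congrArg _ (sub_self _)).trans (map_zero _)

theorem evenAct_uppAct (x : Even k m n) (e : Upp k m n) :
    evenAct ρ x * uppAct ρ e - uppAct ρ e * evenAct ρ x = uppAct ρ (x.1 * e - e * x.2) := by
  rw [← sub_eq_zero]
  refine eq_zero_of_recursion (-1 : k) (fun f => ?_) fun v => ?_
  · have h1 := evenAct_mul_extMul ρ x f
    have h2 := uppAct_mul_extMul ρ e f
    have h3 := uppAct_mul_extMul ρ e (evenLow x f)
    have h4 := uppAct_mul_extMul ρ (x.1 * e - e * x.2) f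
    have h5 := evenAct_commutator ρ hρ x (uppLow e f)
    have h6 : x * uppLow e f - uppLow e f * x =
        uppLow (x.1 * e - e * x.2) f + uppLow e (evenLow x f) := by
      ext1 <;> simp only [evenLow_apply, uppLow_apply, Prod.fst_sub, Prod.snd_sub, Prod.fst_mul,
        Prod.snd_mul, Prod.fst_add, Prod.snd_add, Matrix.sub_mul, Matrix.mul_sub,
        Matrix.mul_assoc] <;> abel
    rw [h6, map_add] at h5
    rw [neg_one_smul]
    linear_combination (norm := noncomm_ring) evenAct ρ x * h2 - h1 * uppAct ρ e -
      (uppAct ρ e * h1 + h2 * evenAct ρ x + h3) - h4 + h5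
  · simp only [LinearMap.sub_apply, Module.End.mul_apply, evenAct_one_tmul, uppAct_one_tmul,
      map_zero, sub_self]

theorem uppAct_anticommutator (e e' : Upp k m n) :
    uppAct ρ e * uppAct ρ e' + uppAct ρ e' * uppAct ρ e = 0 := by
  refine eq_zero_of_recursion (1 : k) (fun f => ?_) fun v => ?_
  · have h1 := uppAct_mul_extMul ρ e f
    have h2 := uppAct_mul_extMul ρ e' f
    have h3 := evenAct_uppAct ρ hρ (uppLow e' f) e
    have h4 := evenAct_uppAct ρ hρ (uppLow e f) e'
    -- The Jacobi identity for `e`, `e'`, `f`, where `[e,e'] = 0`.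
    have h5 : (uppLow e f).1 * e' - e' * (uppLow e f).2 =
        -((uppLow e' f).1 * e - e * (uppLow e' f).2) := by
      simp only [uppLow_apply, Matrix.mul_assoc]
      abel
    rw [h5, map_neg] at h4
    rw [one_smul]
    linear_combination (norm := noncomm_ring) uppAct ρ e * h2 - h1 * uppAct ρ e' +
      uppAct ρ e' * h1 - h2 * uppAct ρ e - h3 - h4
  · simp only [LinearMap.add_apply, Module.End.mul_apply, uppAct_one_tmul, map_zero, add_zero]

omit hρ

theorem evenAct_zero_zero : evenAct ρ ((0, 0) : Even k m n) = 0 := map_zero _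

/-- The action of all matrices on the model. -/
def modelAct : Mat k m n →ₗ[k] Module.End k (Model k m n M) where
  toFun x := evenAct ρ (x.toBlocks₁₁, x.toBlocks₂₂) + extMul M x.toBlocks₂₁ +
    uppAct ρ x.toBlocks₁₂
  map_add' x y := by
    have h1 : ((x + y).toBlocks₁₁, (x + y).toBlocks₂₂) =
      (x.toBlocks₁₁, x.toBlocks₂₂) + (y.toBlocks₁₁, y.toBlocks₂₂) := rfl
    have h2 : (x + y).toBlocks₂₁ = x.toBlocks₂₁ + y.toBlocks₂₁ := rfl
    have h3 : (x + y).toBlocks₁₂ = x.toBlocks₁₂ + y.toBlocks₁₂ := rfl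
    rw [h1, h2, h3, map_add, map_add, map_add]
    abel
  map_smul' c x := by
    have h1 : ((c • x).toBlocks₁₁, (c • x).toBlocks₂₂) = c • (x.toBlocks₁₁, x.toBlocks₂₂) := rfl
    have h2 : (c • x).toBlocks₂₁ = c • x.toBlocks₂₁ := rfl
    have h3 : (c • x).toBlocks₁₂ = c • x.toBlocks₁₂ := rfl
    rw [h1, h2, h3, map_smul, map_smul, map_smul, smul_add, smul_add, RingHom.id_apply]

theorem modelAct_fromBlocks (A B C D) :
    modelAct ρ (Matrix.fromBlocks A B C D) = evenAct ρ (A, D) + extMul M C + uppAct ρ B := rfl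

theorem exists_fromBlocks_of_mem_zero {x : Mat k m n} (hx : x ∈ homogeneous k m n 0) :
    ∃ A D, x = Matrix.fromBlocks A 0 0 D := by
  refine ⟨x.toBlocks₁₁, x.toBlocks₂₂, ?_⟩
  conv_lhs => rw [← Matrix.fromBlocks_toBlocks x]
  congr 1 <;> ext i j <;> exact hx _ _ (by simp [parity])

theorem exists_fromBlocks_of_mem_one {x : Mat k m n} (hx : x ∈ homogeneous k m n 1) :
    ∃ B C, x = Matrix.fromBlocks 0 B C 0 := by
  refine ⟨x.toBlocks₁₂, x.toBlocks₂₁, ?_⟩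
  conv_lhs => rw [← Matrix.fromBlocks_toBlocks x]
  congr 1 <;> ext i j <;> exact hx _ _ (by simp [parity])

include hρ

theorem modelAct_mul (a b : ZMod 2) (x y : Mat k m n) (hx : x ∈ homogeneous k m n a)
    (hy : y ∈ homogeneous k m n b) :
    modelAct ρ x * modelAct ρ y = sign k a b • (modelAct ρ y * modelAct ρ x) +
      modelAct ρ (bracket a b x y) := by
  have h01 : ∀ c : ZMod 2, c = 0 ∨ c = 1 := by decide
  obtain rfl | rfl := h01 a
  · obtain ⟨A, D, rfl⟩ := exists_fromBlocks_of_mem_zero hx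
    obtain rfl | rfl := h01 b
    · obtain ⟨A', D', rfl⟩ := exists_fromBlocks_of_mem_zero hy
      simp only [bracket, sign, Matrix.fromBlocks_multiply, map_sub]
      simp [modelAct_fromBlocks]
      have := evenAct_commutator ρ hρ (A, D) (A', D')
      rw [map_sub] at this
      exact (sub_eq_iff_eq_add'.1 this)
    · obtain ⟨B, C, rfl⟩ := exists_fromBlocks_of_mem_one hy
      simp only [bracket, sign, Matrix.fromBlocks_multiply, map_sub]
      simp [modelAct_fromBlocks, evenAct_zero_zero]
      have h1 := evenAct_uppAct ρ hρ (A, D) B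
      have h2 := evenAct_mul_extMul ρ (A, D) C
      rw [evenLow_apply] at h2
      rw [map_sub] at h1 h2
      linear_combination (norm := noncomm_ring) h1 + h2
  · obtain ⟨B, C, rfl⟩ := exists_fromBlocks_of_mem_one hx
    obtain rfl | rfl := h01 b
    · obtain ⟨A, D, rfl⟩ := exists_fromBlocks_of_mem_zero hy
      simp only [bracket, sign, Matrix.fromBlocks_multiply, map_sub]
      simp [modelAct_fromBlocks, evenAct_zero_zero]
      have h1 := evenAct_uppAct ρ hρ (A, D) B
      have h2 := evenAct_mul_extMul ρ (A, D) C
      rw [evenLow_apply] at h2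
      rw [map_sub] at h1 h2
      linear_combination (norm := noncomm_ring) - h1 - h2
    · obtain ⟨B', C', rfl⟩ := exists_fromBlocks_of_mem_one hy
      simp only [bracket, sign, Matrix.fromBlocks_multiply, map_sub]
      simp [modelAct_fromBlocks, evenAct_zero_zero]
      have h1 := uppAct_mul_extMul ρ B C'
      have h2 := uppAct_mul_extMul ρ B' C
      have h3 := uppAct_anticommutator ρ hρ B B'
      have h4 := extMul_mul_add (k := k) (M := M) C C'
      -- The diagonal blocks of `xy + yx` are regrouped as `[B,C'] + [B',C]`; only the second
      -- components trade places.
      have h5 : evenAct ρ (B * C', C * B') + evenAct ρ (B' * C, C' * B) =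
        evenAct ρ (uppLow B C') + evenAct ρ (uppLow B' C) := by
        rw [← map_add, ← map_add]
        congr 1
        ext1
        · rfl
        · exact add_comm _ _
      linear_combination (norm := noncomm_ring) h1 + h2 + h3 + h4 - h5

end Model

/-! ### Lowering operators for `gl` -/

section Lowering

open Finset

variable {k : Type*} [Field k] {I : Type*} [LinearOrder I] [Fintype I]
  {M : Type*} [AddCommGroup M] [Module k M]

/-- The denominators in the recursion for the lowering operators. -/
def lowDen (lam : I → k) (r j : I) : k := lam r - lam j + #{i : I | r < i ∧ i < j}

/-- Lowering operators: applied to a vector `v` of highest weight `λ` for `gl`, they give a family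
of vectors `m_j` with `E_{ab} m_j = δ_{jb} m_a` for `a < b` and `m_r = v`. -/
def lowOp (E : I → I → Module.End k M) (lam : I → k) (r j : I) : Module.End k M :=
  if j = r then 1 else if r < j then
    (lowDen lam r j)⁻¹ • ∑ i : {i : I // i < j}, E j i * lowOp E lam r i else 0
termination_by (wellFounded_lt (α := I)).wrap j
decreasing_by exact i.2

variable {E : I → I → Module.End k M} {lam : I → k} {r : I}

theorem lowOp_self : lowOp E lam r r = 1 := by
  rw [lowOp, if_pos rfl]

theorem lowOp_of_lt {j : I} (h : j < r) : lowOp E lam r j = 0 := by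
  rw [lowOp, if_neg h.ne, if_neg h.not_gt]

theorem lowDen_smul_lowOp {j : I} (h : r < j) (hd : lowDen lam r j ≠ 0) :
    lowDen lam r j • lowOp E lam r j = ∑ i with i < j, E j i * lowOp E lam r i := by
  rw [lowOp, if_neg h.ne', if_pos h, smul_inv_smul₀ hd]
  exact (Finset.sum_subtype _ (by simp) fun i => E j i * lowOp E lam r i).symm

/-- Makes the lowering operators of the two blocks independent: operators of one block pass through
lowering operators of the other. -/
theorem commute_lowOp {X : Module.End k M} (hX : ∀ a b, Commute X (E a b)) (j : I) :
    Commute X (lowOp E lam r j) := by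
  induction j using WellFoundedLT.induction with
  | ind j ih =>
    rw [lowOp]
    split_ifs with h1 h2
    · exact Commute.one_right X
    · refine Commute.smul_right (Commute.sum_right _ _ _ ?_) _
      rintro ⟨i, hi⟩ _
      exact (hX j i).mul_right (ih i hi)
    · exact Commute.zero_right X

variable (hE : ∀ a b c d, E a b * E c d =
    E c d * E a b + (if b = c then E a d else 0) - (if d = a then E c b else 0))
  (hd : ∀ j, r < j → lowDen lam r j ≠ 0)
  {v : M} (hv : ∀ a, E a a v = lam a • v)

include hE hd hv

theorem weight_lowOp (a j : I) : E a a (lowOp E lam r j v) =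
    (lam a - (if a = r then 1 else 0) + (if a = j then 1 else 0)) • lowOp E lam r j v := by
  induction j using WellFoundedLT.induction with
  | ind j ih =>
    rcases lt_trichotomy j r with h | rfl | h
    · simp [lowOp_of_lt h]
    · simp [lowOp_self, hv]
    · have h1 := LinearMap.congr_fun (lowDen_smul_lowOp (E := E) h (hd j h)) v
      rw [LinearMap.smul_apply, LinearMap.sum_apply] at h1
      refine smul_right_injective M (hd j h) ?_
      simp only
      rw [← map_smul, smul_comm, h1, map_sum, smul_sum]
      refine sum_congr rfl fun i hi => ?_
      have h2 := LinearMap.congr_fun (hE a a j i) (lowOp E lam r i v)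
      rw [Module.End.mul_apply, LinearMap.sub_apply, LinearMap.add_apply, Module.End.mul_apply,
        ih i (by simpa using hi), map_smul] at h2
      rw [Module.End.mul_apply, h2]
      by_cases h3 : a = j
      · subst h3
        have h4 : a ≠ i := by
          rintro rfl
          simp at hi
        simp [h4, h4.symm, add_smul]
      · by_cases h4 : a = i
        · subst h4
          simp [h3, add_smul]
        · simp [h3, h4, Ne.symm h4]

variable (hup : ∀ a b, a < b → E a b v = 0)

omit hup in
-- Split `S` at `a`. The indices below `a` contribute `lowDen` times `m_a` by the recursion when `r
-- < a`, the index `a` contributes the weight, and each index above contributes one `m_a`; the term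
-- `λ_a` cancels. It is stated for initial segments because the induction for `raise_lowOp` needs it
-- before the raising relations are known for all indices.
theorem sum_lowOp (S : Finset I) {a : I} (ha : a ∈ S) (hS : ∀ i ∈ S, ∀ i' < i, i' ∈ S)
    (hI : ∀ i ∈ S, a < i → E a i (lowOp E lam r i v) = lowOp E lam r a v) :
    ∑ i ∈ S, E a i (lowOp E lam r i v) =
      (lam r + (#{i ∈ S | r < i} : k)) • lowOp E lam r a v := by
  rcases lt_or_ge a r with har | har
  · rw [lowOp_of_lt har, LinearMap.zero_apply, smul_zero]
    refine sum_eq_zero fun i hi => ?_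
    rcases lt_or_ge a i with h | h
    · rw [hI i hi h, lowOp_of_lt har, LinearMap.zero_apply]
    · rw [lowOp_of_lt (h.trans_lt har), LinearMap.zero_apply, map_zero]
  have e1 : S = (filter (· < a) univ ∪ {a}) ∪ filter (a < ·) S := by
    ext i
    simp only [mem_union, mem_filter, mem_univ, true_and, mem_singleton]
    constructor
    · intro hi
      rcases lt_trichotomy i a with h | h | h
      · exact .inl (.inl h)
      · exact .inl (.inr h)
      · exact .inr ⟨hi, h⟩
    · rintro ((h | rfl) | h)
      · exact hS a ha i h
      · exact ha
      · exact h.1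
  have d1 : Disjoint (filter (· < a) univ ∪ {a}) (filter (a < ·) S) := by
    rw [disjoint_left]
    intro i hi hi'
    simp only [mem_union, mem_filter, mem_univ, true_and, mem_singleton] at hi hi'
    rcases hi with h | rfl
    · exact h.not_gt hi'.2
    · exact lt_irrefl _ hi'.2
  have d2 : Disjoint (filter (· < a) (univ : Finset I)) {a} := by simp
  have hsum3 : ∑ i ∈ filter (a < ·) S, E a i (lowOp E lam r i v) =
      (#(filter (a < ·) S) : k) • lowOp E lam r a v := by
    rw [sum_congr rfl fun i hi => hI i (mem_filter.1 hi).1 (mem_filter.1 hi).2, sum_const,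
      Nat.cast_smul_eq_nsmul]
  have hsum : ∑ i ∈ S, E a i (lowOp E lam r i v) =
      ∑ i with i < a, E a i (lowOp E lam r i v) +
        E a a (lowOp E lam r a v) + (#(filter (a < ·) S) : k) • lowOp E lam r a v := by
    conv_lhs => rw [e1]
    rw [sum_union d1, sum_union d2, hsum3, sum_singleton]
  rw [hsum, weight_lowOp hE hd hv]
  rcases har.eq_or_lt with rfl | har
  · rw [sum_eq_zero, zero_add, ← add_smul]
    · simp
    · intro i hi
      rw [lowOp_of_lt (by simpa using hi), LinearMap.zero_apply, map_zero]
  · have h1 := LinearMap.congr_fun (lowDen_smul_lowOp (E := E) har (hd a har)) v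
    rw [LinearMap.smul_apply, LinearMap.sum_apply] at h1
    simp only [Module.End.mul_apply] at h1
    rw [← h1, ← add_smul, ← add_smul]
    congr 1
    have hc : #{i ∈ S | r < i} = #{i : I | r < i ∧ i < a} + 1 + #(filter (a < ·) S) := by
      conv_lhs => rw [e1]
      rw [filter_union, filter_union, card_union_of_disjoint, card_union_of_disjoint]
      · congr 1
        · congr 1
          · rw [filter_filter]
            congr 1
            ext i
            simp [and_comm]
          · rw [filter_singleton, if_pos har, card_singleton]
        · rw [filter_filter]
          congr 1
          ext i
          simp only [mem_filter, and_congr_right_iff, and_iff_left_iff_imp]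
          exact fun _ h => har.trans h
      · exact disjoint_filter_filter d2
      · rw [← filter_union]
        exact disjoint_filter_filter d1
    rw [hc, lowDen]
    push_cast
    simp only [har.ne', if_true, if_false]
    ring

include hup

/-- `E_{ab}` is applied to the recursion `lowDen • m_j = ∑_{i<j} E_{ji} m_i`. For `b < j` two terms
`E_{jb} m_a` cancel. For `b = j` the remainder is `∑_{i<b} E_{ai} m_i - E_{bb} m_a`, and `sum_lowOp`
evaluates it to exactly `lowDen • m_a`, which explains the choice of denominator. The relations say
that `∑ ξ_j ⊗ m_j`, with `ξ_j` the dual basis of the natural module, is killed by the raising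
operators. -/
theorem raise_lowOp (j : I) : ∀ a b, a < b →
    E a b (lowOp E lam r j v) = if j = b then lowOp E lam r a v else 0 := by
  induction j using WellFoundedLT.induction with
  | ind j ih =>
    intro a b hab
    rcases lt_trichotomy j r with h | rfl | h
    · rw [lowOp_of_lt h, LinearMap.zero_apply, map_zero]
      split_ifs with hj
      · subst hj
        rw [lowOp_of_lt (hab.trans h), LinearMap.zero_apply]
      · rfl
    · rw [lowOp_self, Module.End.one_apply, hup a b hab]
      split_ifs with hj
      · subst hj
        rw [lowOp_of_lt hab, LinearMap.zero_apply]
      · rfl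
    · have h1 := LinearMap.congr_fun (lowDen_smul_lowOp (E := E) h (hd j h)) v
      rw [LinearMap.smul_apply, LinearMap.sum_apply] at h1
      refine smul_right_injective M (hd j h) ?_
      simp only
      rw [← map_smul, h1, map_sum]
      have h2 : ∀ i ∈ filter (· < j) univ, E a b ((E j i * lowOp E lam r i) v) =
          (if i = b then E j b (lowOp E lam r a v) else 0) +
          (if b = j then E a i (lowOp E lam r i v) else 0) -
          (if i = a then E j b (lowOp E lam r a v) else 0) := by
        intro i hi
        have h3 := LinearMap.congr_fun (hE a b j i) (lowOp E lam r i v)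
        rw [Module.End.mul_apply, LinearMap.sub_apply, LinearMap.add_apply, Module.End.mul_apply,
          ih i (by simpa using hi) a b hab] at h3
        rw [Module.End.mul_apply, h3]
        congr 1
        · congr 1
          · split_ifs with e
            · rw [e]
            · rw [map_zero]
          · split_ifs <;> rfl
        · split_ifs with e
          · rw [e]
          · rfl
      rw [sum_congr rfl h2, sum_sub_distrib, sum_add_distrib, sum_ite_eq', sum_ite_eq']
      simp only [mem_filter, mem_univ, true_and]
      rcases lt_trichotomy b j with hbj | rfl | hbj
      · rw [if_pos hbj, if_pos (hab.trans hbj), if_neg hbj.ne', sum_eq_zero]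
        · simp
        · intro i _
          rw [if_neg hbj.ne]
      · simp only [lt_irrefl, if_true, if_false, if_pos hab]
        rw [sum_lowOp hE hd hv (filter (· < b) univ) (by simpa using hab)
          (fun i hi i' hi' => by
            simp only [mem_filter, mem_univ, true_and] at hi ⊢
            exact hi'.trans hi)
          (fun i hi hai => by
            rw [ih i (by simpa using hi) a i hai, if_pos rfl]), weight_lowOp hE hd hv,
          zero_add, ← sub_smul]
        congr 1
        rw [lowDen, filter_filter, if_neg h.ne', if_neg hab.ne']
        simp only [and_comm]
        ring
      · rw [if_neg hbj.not_gt, if_neg hbj.ne, smul_zero, sum_eq_zero, zero_add, zero_sub,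
          neg_eq_zero]
        · split_ifs with haj
          · rw [ih a haj j b hbj, if_neg hab.ne]
          · rfl
        · intro i _
          rw [if_neg hbj.ne']

theorem sum_univ_lowOp (a : I) : ∑ i, E a i (lowOp E lam r i v) =
    (lam r + (#{i : I | r < i} : k)) • lowOp E lam r a v :=
  sum_lowOp hE hd hv univ (mem_univ a) (fun _ _ _ _ => mem_univ _) fun i _ hai => by
    rw [raise_lowOp hE hd hv hup i a i hai, if_pos rfl]

end Lowering

/-! ### Polynomial modules over `gl(m) × gl(n)` -/

section Polynomial

open MvPolynomial Finset

variable {k : Type*} [Field k]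

theorem derivation_prod {A : Type*} [CommRing A] [Algebra k A] (D : Derivation k A A)
    {I : Type*} [DecidableEq I] (s : Finset I) (f : I → A) :
    D (∏ i ∈ s, f i) = ∑ i ∈ s, (∏ j ∈ s.erase i, f j) * D (f i) := by
  induction s using Finset.induction_on with
  | empty => simp
  | insert a s ha ih =>
    rw [prod_insert ha, Derivation.leibniz, ih, sum_insert ha, erase_insert ha, smul_eq_mul,
      smul_eq_mul, mul_sum, add_comm]
    congr 1
    refine sum_congr rfl fun i hi => ?_
    have hne : a ≠ i := by
      rintro rfl
      exact ha hi
    rw [erase_insert_of_ne hne, prod_insert (fun h => ha (mem_of_mem_erase h)), mul_assoc]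

theorem derivation_det {A : Type*} [CommRing A] [Algebra k A] (D : Derivation k A A)
    {I : Type*} [DecidableEq I] [Fintype I] (B : Matrix I I A) :
    D B.det = ∑ i, (B.updateCol i fun p => D (B p i)).det := by
  simp only [Matrix.det_apply, map_sum]
  rw [sum_comm]
  refine sum_congr rfl fun σ _ => ?_
  rw [← smul_sum, Units.smul_def, Units.smul_def, map_zsmul, derivation_prod]
  congr 1
  refine sum_congr rfl fun i _ => ?_
  rw [← mul_prod_erase univ _ (mem_univ i), mul_comm, Matrix.updateCol_self]
  congr 1
  refine prod_congr rfl fun j hj => ?_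
  rw [Matrix.updateCol_ne (ne_of_mem_erase hj)]

variable {J : Type*} [Fintype J]

/-- The action of matrices on polynomials in several vectors by derivations. -/
def polyDer (x : Matrix J J k) : Derivation k (MvPolynomial (J × J) k) (MvPolynomial (J × J) k) :=
  mkDerivation k fun q => ∑ a, x a q.1 • X (a, q.2)

theorem polyDer_X (x : Matrix J J k) (q : J × J) :
    polyDer x (X q) = ∑ a, x a q.1 • X (a, q.2) := mkDerivation_X _ _ _

/-- The action of matrices on polynomials, as a linear map. -/
def polyDerₗ : Matrix J J k →ₗ[k] Module.End k (MvPolynomial (J × J) k) where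
  toFun x := (polyDer x).toLinearMap
  map_add' x y := by
    have : polyDer (x + y) = polyDer x + polyDer y := by
      refine derivation_ext fun q => ?_
      simp [polyDer_X, add_smul, sum_add_distrib]
    rw [this]
    rfl
  map_smul' c x := by
    have : polyDer (c • x) = c • polyDer x := by
      refine derivation_ext fun q => ?_
      simp [polyDer_X, smul_sum, mul_smul]
    rw [this]
    rfl

theorem polyDerₗ_apply (x : Matrix J J k) (v : MvPolynomial (J × J) k) :
    polyDerₗ x v = polyDer x v := rfl

theorem polyDer_mul_sub (x y : Matrix J J k) : polyDer (x * y - y * x) = ⁅polyDer x, polyDer y⁆ := by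
  have key (x y : Matrix J J k) (q : J × J) :
      polyDer x (polyDer y (X q)) = ∑ b, (x * y) b q.1 • X (b, q.2) := by
    simp only [polyDer_X, map_sum, Derivation.map_smul, smul_sum, Matrix.mul_apply, sum_smul,
      smul_smul]
    rw [sum_comm]
    refine sum_congr rfl fun b _ => sum_congr rfl fun a _ => ?_
    rw [mul_comm]
  refine derivation_ext fun q => ?_
  rw [Derivation.commutator_apply, key, key, polyDer_X, ← sum_sub_distrib]
  refine sum_congr rfl fun b _ => ?_
  rw [← sub_smul, Matrix.sub_apply]

theorem polyDerₗ_commutator (x y : Matrix J J k) :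
    polyDerₗ x * polyDerₗ y - polyDerₗ y * polyDerₗ x = polyDerₗ (x * y - y * x) := by
  refine LinearMap.ext fun v => ?_
  rw [polyDerₗ_apply, polyDer_mul_sub, Derivation.commutator_apply]
  rfl

/-- The principal minor of the generic matrix with rows and columns in `S`. -/
def polyMinor (k : Type*) [Field k] {J : Type*} [DecidableEq J] (S : Finset J) : MvPolynomial (J × J) k :=
  (Matrix.of fun p i : S => (X (i.1, p.1) : MvPolynomial (J × J) k)).det

/-- Evaluation of the variables at the identity matrix turns the minor into `1`. -/
theorem polyMinor_ne_zero {J : Type*} [DecidableEq J] (S : Finset J) : polyMinor k S ≠ 0 := by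
  intro h
  have h1 := congrArg (MvPolynomial.eval fun q : J × J => if q.1 = q.2 then (1 : k) else 0) h
  rw [polyMinor, RingHom.map_det, map_zero] at h1
  have h2 : (MvPolynomial.eval fun q : J × J => if q.1 = q.2 then (1 : k) else 0).mapMatrix
      (Matrix.of fun p i : S => (X (i.1, p.1) : MvPolynomial (J × J) k)) = 1 := by
    ext p i
    change MvPolynomial.eval _ (X (i.1, p.1)) = _
    rw [eval_X, Matrix.one_apply]
    refine if_congr ?_ rfl rfl
    rw [Subtype.ext_iff, eq_comm]
  rw [h2, Matrix.det_one] at h1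
  exact one_ne_zero h1

variable [DecidableEq J]

theorem polyDer_single_X (a b : J) (q : J × J) :
    polyDer (Matrix.single a b (1 : k)) (X q) = if b = q.1 then X (a, q.2) else 0 := by
  rw [polyDer_X, sum_eq_single a]
  · simp [Matrix.single_apply]
  · intro c _ hc
    rw [Matrix.single_apply_of_row_ne hc.symm, zero_smul]
  · simp

/-- `E_{ab}` replaces column `b` of the minor by column `a`. If `a ≠ b` both lie in `S`, two columns
agree; if `b` is not in `S`, nothing is left. -/
theorem polyDer_polyMinor (S : Finset J) (a b : J) (hab : b ∈ S → a ∈ S) :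
    polyDer (Matrix.single a b (1 : k)) (polyMinor k S) =
      if a = b ∧ a ∈ S then polyMinor k S else 0 := by
  rw [polyMinor, derivation_det]
  simp only [Matrix.of_apply, polyDer_single_X]
  by_cases hb : b ∈ S
  · rw [sum_eq_single ⟨b, hb⟩]
    · by_cases h : a = b
      · subst h
        rw [if_pos ⟨rfl, hb⟩]
        congr 1
        ext p i
        by_cases hi : i = ⟨a, hb⟩
        · subst hi
          simp
        · rw [Matrix.updateCol_ne hi]
      · rw [if_neg fun h' => h h'.1]
        have hne : (⟨a, hab hb⟩ : S) ≠ ⟨b, hb⟩ := fun h' => h (congrArg Subtype.val h')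
        refine Matrix.det_zero_of_column_eq hne fun p => ?_
        rw [Matrix.updateCol_ne hne, Matrix.updateCol_self]
        simp
    · intro i _ hi
      refine Matrix.det_eq_zero_of_column_eq_zero i fun p => ?_
      rw [Matrix.updateCol_self, if_neg]
      exact fun h => hi (Subtype.ext h.symm)
    · simp
  · rw [sum_eq_zero, if_neg]
    · rintro ⟨rfl, h⟩
      exact hb h
    · intro i _
      refine Matrix.det_eq_zero_of_column_eq_zero i fun p => ?_
      rw [Matrix.updateCol_self, if_neg]
      rintro rfl
      exact hb i.2

/-- Existence of polynomial highest weight vectors, for the partial order on labels given by `R`. -/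
theorem exists_polyHighestWeight (R : J → J → Prop) (l : J → ℕ)
    (hl : ∀ a b, R a b → l b ≤ l a) : ∃ v : MvPolynomial (J × J) k, v ≠ 0 ∧ ∀ a b, R a b →
      polyDer (Matrix.single a b (1 : k)) v = if a = b then (l a : k) • v else 0 := by
  induction h : ∑ a, l a using Nat.strong_induction_on generalizing l with
  | _ N ih =>
    by_cases h0 : ∀ a, l a = 0
    · refine ⟨1, one_ne_zero, fun a b _ => ?_⟩
      simp [h0]
    · push Not at h0
      obtain ⟨a₀, ha₀⟩ := h0
      obtain ⟨v, hv0, hv⟩ := ih (∑ a, (l a - 1)) (by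
        rw [← h]
        refine sum_lt_sum (fun a _ => Nat.sub_le _ _) ⟨a₀, mem_univ _, by omega⟩)
        (fun a => l a - 1) (fun a b hab => Nat.sub_le_sub_right (hl a b hab) 1) rfl
      -- The minor on the support of `l` has weight the indicator of that support, and subtracting
      -- it gives `l - 1` truncated at zero. Monotonicity of `l` along `R` gives the closure
      -- condition of `polyDer_polyMinor`.
      refine ⟨polyMinor k (univ.filter fun a => l a ≠ 0) * v,
        mul_ne_zero (polyMinor_ne_zero _) hv0, fun a b hab => ?_⟩
      rw [Derivation.leibniz, hv a b hab, polyDer_polyMinor]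
      · by_cases e : a = b
        · subst e
          by_cases hla : l a = 0
          · simp [hla]
          · have : ((l a - 1 : ℕ) : k) = (l a : k) - 1 := by
              rw [Nat.cast_sub (by omega), Nat.cast_one]
            simp [hla, this, sub_smul, mul_comm, sub_mul]
        · simp [e]
      · simp only [mem_filter, mem_univ, true_and]
        have := hl a b hab
        omega

end Polynomial

/-! ### Nonzero Verma modules of `𝔤₀` for dominant weights -/

section EvenModules

variable {k : Type*} [Field k] {m n : ℕ}

/-- Extension to the enveloping algebra of a representation of `𝔤₀`. -/
def liftU₀ {A : Type*} [Ring A] [Algebra k A] (f : (g₀ k m n).carrier →ₗ[k] A)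
    (hf : ∀ x y z : (g₀ k m n).carrier,
      (z : Mat k m n) = (x : Mat k m n) * y - (y : Mat k m n) * x → f x * f y - f y * f x = f z) :
    U (g₀ k m n) →ₐ[k] A :=
  liftU f (by
    have h01 : ∀ c : ZMod 2, c = 0 ∨ c = 1 := by decide
    have h1 : ∀ x : (g₀ k m n).carrier, (x : Mat k m n) ∈ homogeneous k m n 1 → x = 0 := by
      intro x hx
      ext i j
      by_cases h : parity i + parity j = 0
      · exact hx i j (by rw [h]; decide)
      · exact x.2 i j h
    intro a b x y z hx hy hz
    obtain rfl | rfl := h01 a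
    · rw [← hf x y z (by simpa [bracket, sign] using hz)]
      simp [sign]
    · obtain rfl := h1 x hx
      obtain rfl : z = 0 := Subtype.ext (by simpa [bracket] using hz)
      simp)

@[simp]
theorem liftU₀_ι {A : Type*} [Ring A] [Algebra k A] (f : (g₀ k m n).carrier →ₗ[k] A) (hf)
    (x : (g₀ k m n).carrier) : liftU₀ f hf (ι _ x) = f x := liftU_ι _ _ x

/-- A representation with a nonzero highest weight vector shows that the Verma module
is nonzero. -/
theorem vermaVec_ne_zero_of_algHom {s : SubSuperalgebra k m n} (hs : IsRegular s) {N : Type*}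
    [AddCommGroup N] [Module k N] (Φ : U s →ₐ[k] Module.End k N) {mu : Weight k m n} {w : N}
    (h0 : w ≠ 0) (hw : ∀ i j (h : Matrix.single i j (1 : k) ∈ s.carrier), pos i ≤ pos j →
      Φ (ι s ⟨_, h⟩) w = if i = j then mu i • w else 0) : vermaVec s mu ≠ 0 := by
  let : Module (U s) N := Module.compHom N Φ.toRingHom
  have : IsScalarTower k (U s) N := ⟨fun c u v => by
    change Φ (c • u) v = c • Φ u v
    rw [map_smul, LinearMap.smul_apply]⟩
  exact vermaVec_ne_zero (isHighestWeight_of_single hs hw) h0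

theorem evalDiag_commutator (c d : k) {x y : Mat k m n} (hx : x ∈ homogeneous k m n 0)
    (hy : y ∈ homogeneous k m n 0) :
    evalDiag (Sum.elim (fun _ => c) (fun _ => d)) (x * y - y * x) = 0 := by
  obtain ⟨A, D, rfl⟩ := exists_fromBlocks_of_mem_zero hx
  obtain ⟨A', D', rfl⟩ := exists_fromBlocks_of_mem_zero hy
  have h1 := Matrix.trace_mul_comm A A'
  have h2 := Matrix.trace_mul_comm D D'
  simp only [Matrix.trace, Matrix.diag] at h1 h2
  simp [evalDiag, Matrix.fromBlocks_multiply, ← Finset.mul_sum, h1, h2]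

theorem parity_eq_of_single_mem {i j : Idx m n}
    (h : Matrix.single i j (1 : k) ∈ (g₀ k m n).carrier) : parity i = parity j := by
  by_contra hne
  have := h i j (fun e => hne (CharTwo.add_eq_zero.1 e))
  simp at this

theorem single_mem_g₀ {i j : Idx m n} (h : parity i = parity j) :
    Matrix.single i j (1 : k) ∈ (g₀ k m n).carrier := by
  have := single_mem_homogeneous (k := k) i j 1
  rwa [h, CharTwo.add_self_eq_zero] at this

/-- The Verma module of `𝔤₀` is nonzero if the highest weight is a decreasing sequence of natural
numbers on each block, up to a character of `𝔤₀`. -/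
theorem vermaVec_ne_zero_of_nat (c d : k) (l : Idx m n → ℕ)
    (hl : ∀ i j, pos i ≤ pos j → parity i = parity j → l j ≤ l i) {lam : Weight k m n}
    (hlam : ∀ i, lam i = l i + Sum.elim (fun _ => c) (fun _ => d) i) :
    vermaVec (g₀ k m n) lam ≠ 0 := by
  obtain ⟨v, hv0, hv⟩ := exists_polyHighestWeight (k := k) (J := Idx m n)
    (fun a b => pos a ≤ pos b ∧ parity a = parity b) l
    (fun a b h => hl a b h.1 h.2)
  -- The polynomial representation is twisted by the character `c tr A + d tr D`, which vanishes on
  -- commutators and supplies the non-integral part of the weight.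
  let χ : Weight k m n := Sum.elim (fun _ => c) (fun _ => d)
  let f : (g₀ k m n).carrier →ₗ[k] Module.End k (MvPolynomial (Idx m n × Idx m n) k) :=
    (polyDerₗ + (Algebra.linearMap k _) ∘ₗ evalDiagₗ χ) ∘ₗ (g₀ k m n).carrier.subtype
  have hf : ∀ x y z : (g₀ k m n).carrier,
      (z : Mat k m n) = (x : Mat k m n) * y - (y : Mat k m n) * x →
        f x * f y - f y * f x = f z := by
    intro x y z hz
    have h1 : evalDiagₗ χ ((x : Mat k m n) * y - (y : Mat k m n) * x) = 0 :=
      evalDiag_commutator c d x.2 y.2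
    simp only [f, LinearMap.comp_apply, Submodule.subtype_apply, LinearMap.add_apply, hz, h1,
      map_zero, add_zero, ← polyDerₗ_commutator, Algebra.linearMap_apply]
    simp only [Algebra.algebraMap_eq_smul_one, add_mul, mul_add, mul_one,
      one_mul, smul_mul_assoc, mul_smul_comm, smul_add]
    rw [smul_comm (evalDiagₗ χ (y : Mat k m n))]
    abel
  refine vermaVec_ne_zero_of_algHom isRegular_g₀ (liftU₀ f hf) hv0 fun i j h hij => ?_
  have h1 := hv i j ⟨hij, parity_eq_of_single_mem h⟩
  have h2 : f ⟨_, h⟩ v = polyDer (Matrix.single i j (1 : k)) v +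
      evalDiag χ (Matrix.single i j (1 : k)) • v := rfl
  rw [liftU₀_ι, h2, h1, evalDiag_single]
  split_ifs with e
  · rw [← add_smul, hlam]
  · rw [zero_smul, zero_add]

theorem form_sub_right (lam mu nu : Weight k m n) :
    form lam (mu - nu) = form lam mu - form lam nu := by
  simp only [form, Pi.sub_apply, mul_sub, Finset.sum_sub_distrib]
  ring

theorem form_single_right (lam : Weight k m n) (a : Idx m n) :
    form lam (Pi.single a 1) =
      Sum.elim (fun i => lam (Sum.inl i)) (fun j => -lam (Sum.inr j)) a := by
  cases a <;> simp [form, Pi.single_apply]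

/-- In the second block both the form and `(α, α)` change sign, so `(λ, α^∨)` is the difference of
entries in either block. -/
theorem IsDominant.exists_nat [CharZero k] {lam : Weight k m n} (h : IsDominant lam)
    {i j : Idx m n} (hij : pos i < pos j) (hp : parity i = parity j) :
    ∃ N : ℕ, lam i - lam j = N := by
  obtain ⟨N, hN⟩ := h (i, j) (by simp [evenPos, hij, hp])
  refine ⟨N, ?_⟩
  rw [← hN]
  have hne : i ≠ j := by
    rintro rfl
    exact lt_irrefl _ hij
  have hsmul (c : k) (mu : Weight k m n) : form lam (c • mu) = c * form lam mu := by
    simp only [form, Pi.smul_apply, smul_eq_mul, mul_left_comm _ c, ← Finset.mul_sum, mul_sub]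
  rw [coroot, hsmul, root, form_sub_right, form_sub_right]
  simp only [form_single_right]
  rcases i with i | i <;> rcases j with j | j
  · have hij' : i ≠ j := fun e => hne (congrArg _ e)
    simp [Pi.single_apply, hij', hij'.symm]
    norm_num
  · simp [parity] at hp
  · simp [parity] at hp
  · have hij' : i ≠ j := fun e => hne (congrArg _ e)
    simp [Pi.single_apply, hij', hij'.symm]
    norm_num
    ring

/-- Subtracting from each block its last entry leaves decreasing natural numbers. -/
theorem IsDominant.vermaVec_ne_zero [CharZero k] {lam : Weight k m n} (h : IsDominant lam) :
    vermaVec (g₀ k m n) lam ≠ 0 := by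
  have hex : ∃ c d : k, ∀ i, ∃ N : ℕ, lam i = N + Sum.elim (fun _ => c) (fun _ => d) i := by
    have h1 : ∃ c : k, ∀ i : Fin m, ∃ N : ℕ, lam (Sum.inl i) = N + c := by
      rcases m with - | m
      · exact ⟨0, fun i => i.elim0⟩
      · refine ⟨lam (Sum.inl (Fin.last m)), fun i => ?_⟩
        rcases (Fin.le_last i).eq_or_lt with rfl | hi
        · exact ⟨0, by simp⟩
        · obtain ⟨N, hN⟩ := h.exists_nat (i := Sum.inl i) (j := Sum.inl (Fin.last m)) hi rfl
          exact ⟨N, by rw [← hN]; ring⟩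
    have h2 : ∃ c : k, ∀ i : Fin n, ∃ N : ℕ, lam (Sum.inr i) = N + c := by
      rcases n with - | n
      · exact ⟨0, fun i => i.elim0⟩
      · refine ⟨lam (Sum.inr (Fin.last n)), fun i => ?_⟩
        rcases (Fin.le_last i).eq_or_lt with rfl | hi
        · exact ⟨0, by simp⟩
        · obtain ⟨N, hN⟩ := h.exists_nat (i := Sum.inr i) (j := Sum.inr (Fin.last n))
            (Nat.add_lt_add_left hi _) rfl
          exact ⟨N, by rw [← hN]; ring⟩
    obtain ⟨c, hc⟩ := h1
    obtain ⟨d, hd⟩ := h2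
    exact ⟨c, d, Sum.rec hc hd⟩
  obtain ⟨c, d, hcd⟩ := hex
  choose l hl using hcd
  refine vermaVec_ne_zero_of_nat c d l (fun i j hij hp => ?_) hl
  rcases hij.eq_or_lt with e | hij
  · have : i = j := by
      rcases i with i | i <;> rcases j with j | j
      · exact congrArg _ (Fin.ext e)
      · simp [parity] at hp
      · simp [parity] at hp
      · exact congrArg _ (Fin.ext (Nat.add_left_cancel e))
    rw [this]
  · obtain ⟨N, hN⟩ := h.exists_nat hij hp
    have he : Sum.elim (fun _ => c) (fun _ => d) i = Sum.elim (fun _ => c) (fun _ => d) j := by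
      rcases i with i | i <;> rcases j with j | j
      · rfl
      · simp [parity] at hp
      · simp [parity] at hp
      · rfl
    rw [hl, hl, he, add_sub_add_right_eq_sub, sub_eq_iff_eq_add] at hN
    have : l i = N + l j := by exact_mod_cast hN
    omega

end EvenModules

/-! ### The singular vector of the model -/

section Singular

open Finset OrderDual

variable {k : Type*} [Field k] {m n : ℕ} {M : Type*} [AddCommGroup M] [Module k M]
  (ρ : Even k m n →ₗ[k] Module.End k M)

/-- The operators of the matrix units of `gl(m)`. -/
def leftOp (a b : Fin m) : Module.End k M := ρ (Matrix.single a b 1, 0)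

/-- The operators of the matrix units of `gl(n)`. -/
def rightOp (a b : Fin n) : Module.End k M := ρ (0, Matrix.single a b 1)

/-- The operators of the matrix units of `gl(n)`, twisted by the automorphism `x ↦ -xᵀ` and the
reversal of the order. -/
def dualOp (a b : (Fin n)ᵒᵈ) : Module.End k M := -rightOp ρ (ofDual b) (ofDual a)

theorem single_mul_single {q : ℕ} (a b c d : Fin q) :
    Matrix.single a b (1 : k) * Matrix.single c d 1 = if b = c then Matrix.single a d 1 else 0 := by
  split_ifs with h
  · subst h; simp
  · simp [Matrix.single_mul_single_of_ne, h]

/-- The vectors `m_{ij}` in the singular vector `∑ f_{ji} ⊗ m_{ij}`. -/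
def singularCoeff (lam : Weight k m n) (r : Fin m) (s : Fin n) (v : M) (i : Fin m) (j : Fin n) :
    M :=
  lowOp (dualOp ρ) (fun a => -lam (Sum.inr (ofDual a))) (toDual s) (toDual j)
    (lowOp (leftOp ρ) (fun a => lam (Sum.inl a)) r i v)

/-- The singular vector of the model. -/
def singularVec (lam : Weight k m n) (r : Fin m) (s : Fin n) (v : M) : Model k m n M :=
  ∑ i, ∑ j, extMul M (Matrix.single j i (1 : k))
    (ExtTensor.mk k _ M 1 (singularCoeff ρ lam r s v i j))

theorem singularCoeff_self (lam : Weight k m n) (r : Fin m) (s : Fin n) (v : M) :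
    singularCoeff ρ lam r s v r s = v := by
  rw [singularCoeff, lowOp_self, lowOp_self, Module.End.one_apply, Module.End.one_apply]

/-- The functional reading off the `f_{sr}`-coefficient in exterior degree one sends the vector to
`m_{rs} = v`. -/
theorem singularVec_ne_zero (lam : Weight k m n) (r : Fin m) (s : Fin n) {v : M} (hv : v ≠ 0) :
    singularVec ρ lam r s v ≠ 0 := by
  intro h
  obtain ⟨φ, hφ⟩ : ∃ φ : Low k m n →ₗ[k] k, ∀ C, φ C = C s r :=
    ⟨{ toFun := fun C => C s r, map_add' := fun _ _ => rfl, map_smul' := fun _ _ => rfl },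
      fun _ => rfl⟩
  have h1 := congrArg
    (ExtTensor.lift ((LinearMap.lsmul k M) ∘ₗ φ ∘ₗ ExteriorAlgebra.ιInv)) h
  have h2 (C : Low k m n) : ExteriorAlgebra.ιInv (ExteriorAlgebra.ι k C) = C :=
    ExteriorAlgebra.ι_leftInverse C
  rw [singularVec, map_sum, sum_eq_single r, map_sum, sum_eq_single s] at h1
  · simp [h2, hφ, singularCoeff_self, hv] at h1
  · intro j _ hj
    simp [h2, hφ, hj]
  · simp
  · intro i _ hi
    rw [map_sum]
    refine sum_eq_zero fun j _ => ?_
    simp [h2, hφ, Matrix.single_apply_of_col_ne _ _ hi]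
  · simp

variable {ρ} (hρ : ∀ x y, ρ x * ρ y - ρ y * ρ x = ρ (x * y - y * x))

include hρ

theorem leftOp_mul (a b c d : Fin m) : leftOp ρ a b * leftOp ρ c d = leftOp ρ c d * leftOp ρ a b +
    (if b = c then leftOp ρ a d else 0) - (if d = a then leftOp ρ c b else 0) := by
  have h := hρ (Matrix.single a b 1, 0) (Matrix.single c d 1, 0)
  rw [Prod.mk_mul_mk, Prod.mk_mul_mk, mul_zero, single_mul_single, single_mul_single, map_sub] at h
  simp only [leftOp]
  rw [sub_eq_iff_eq_add'.1 h, add_sub_assoc]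
  congr 2 <;> split_ifs <;> first | rfl | exact map_zero ρ

theorem rightOp_mul (a b c d : Fin n) :
    rightOp ρ a b * rightOp ρ c d = rightOp ρ c d * rightOp ρ a b +
      (if b = c then rightOp ρ a d else 0) - (if d = a then rightOp ρ c b else 0) := by
  have h := hρ (0, Matrix.single a b 1) (0, Matrix.single c d 1)
  rw [Prod.mk_mul_mk, Prod.mk_mul_mk, mul_zero, single_mul_single, single_mul_single, map_sub] at h
  simp only [rightOp]
  rw [sub_eq_iff_eq_add'.1 h, add_sub_assoc]
  congr 2 <;> split_ifs <;> first | rfl | exact map_zero ρ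

/-- `x ↦ -xᵀ` is an automorphism of `gl(n)`. It is needed because the lower blocks form the dual
natural module of `gl(m)` tensored with the natural module of `gl(n)`, whereas lowering operators
are built for a dual factor; the twist negates weights and exchanges the two Borel subalgebras,
hence the reversed order. -/
theorem dualOp_mul (a b c d : (Fin n)ᵒᵈ) :
    dualOp ρ a b * dualOp ρ c d = dualOp ρ c d * dualOp ρ a b +
      (if b = c then dualOp ρ a d else 0) - (if d = a then dualOp ρ c b else 0) := by
  simp only [dualOp, neg_mul_neg]
  rw [rightOp_mul hρ, add_sub_assoc, add_sub_assoc]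
  congr 1
  have e1 : (ofDual a = ofDual d) = (d = a) :=
    propext ((EmbeddingLike.apply_eq_iff_eq _).trans eq_comm)
  have e2 : (ofDual c = ofDual b) = (b = c) :=
    propext ((EmbeddingLike.apply_eq_iff_eq _).trans eq_comm)
  simp only [e1, e2]
  split_ifs <;> abel

theorem commute_leftOp_dualOp (a b : Fin m) (c d : (Fin n)ᵒᵈ) :
    Commute (leftOp ρ a b) (dualOp ρ c d) := by
  refine Commute.neg_right ?_
  have h := hρ (Matrix.single a b 1, 0) (0, Matrix.single (ofDual d) (ofDual c) 1)
  rw [Prod.mk_mul_mk, Prod.mk_mul_mk, mul_zero, zero_mul, mul_zero, zero_mul, sub_self,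
    map_zero] at h
  exact sub_eq_zero.1 h

variable {lam : Weight k m n} {r : Fin m} {s : Fin n} {v : M}
  (hl : ∀ a, leftOp ρ a a v = lam (Sum.inl a) • v)
  (hr : ∀ a, rightOp ρ a a v = lam (Sum.inr a) • v)
  (hl' : ∀ a b, a < b → leftOp ρ a b v = 0)
  (hr' : ∀ a b, a < b → rightOp ρ a b v = 0)
  (hd : ∀ j, r < j → lowDen (fun a => lam (Sum.inl a)) r j ≠ 0)
  (hd' : ∀ j, toDual s < j → lowDen (fun a => -lam (Sum.inr (ofDual a))) (toDual s) j ≠ 0)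

omit hρ in
theorem apply_eq_of_commute {X Y : Module.End k M} (h : Commute X Y) (u : M) :
    X (Y u) = Y (X u) := LinearMap.congr_fun h.eq u

include hl hd in
theorem leftOp_self_singularCoeff (a i : Fin m) (j : Fin n) :
    leftOp ρ a a (singularCoeff ρ lam r s v i j) =
      (lam (Sum.inl a) - (if a = r then 1 else 0) + (if a = i then 1 else 0)) •
        singularCoeff ρ lam r s v i j := by
  rw [singularCoeff, apply_eq_of_commute
    (commute_lowOp (fun c d => commute_leftOp_dualOp hρ a a c d) _),
    weight_lowOp (leftOp_mul hρ) hd hl, map_smul]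

include hl hd hl' in
theorem leftOp_singularCoeff {a b : Fin m} (hab : a < b) (i : Fin m) (j : Fin n) :
    leftOp ρ a b (singularCoeff ρ lam r s v i j) =
      if i = b then singularCoeff ρ lam r s v a j else 0 := by
  rw [singularCoeff, apply_eq_of_commute
    (commute_lowOp (fun c d => commute_leftOp_dualOp hρ a b c d) _),
    raise_lowOp (leftOp_mul hρ) hd hl hl' i a b hab]
  split_ifs
  · rfl
  · rw [map_zero]

include hl hd hl' in
theorem sum_leftOp_singularCoeff (a : Fin m) (j : Fin n) :
    ∑ i, leftOp ρ a i (singularCoeff ρ lam r s v i j) =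
      (lam (Sum.inl r) + (#{i : Fin m | r < i} : k)) • singularCoeff ρ lam r s v a j := by
  have h := sum_univ_lowOp (leftOp_mul hρ) hd hl hl' a
  rw [singularCoeff, ← map_smul, ← h, map_sum]
  refine sum_congr rfl fun i _ => ?_
  rw [singularCoeff, apply_eq_of_commute
    (commute_lowOp (fun c d => commute_leftOp_dualOp hρ a i c d) _)]

include hr in
theorem dualOp_self_lowOp (i : Fin m) (a : (Fin n)ᵒᵈ) :
    dualOp ρ a a (lowOp (leftOp ρ) (fun a => lam (Sum.inl a)) r i v) =
      (-lam (Sum.inr (ofDual a))) • lowOp (leftOp ρ) (fun a => lam (Sum.inl a)) r i v := by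
  rw [apply_eq_of_commute (commute_lowOp (fun c d => (commute_leftOp_dualOp hρ c d a a).symm) _),
    dualOp, LinearMap.neg_apply, hr, ← neg_smul, map_smul]

include hr' in
theorem dualOp_lowOp (i : Fin m) (a b : (Fin n)ᵒᵈ) (hab : a < b) :
    dualOp ρ a b (lowOp (leftOp ρ) (fun a => lam (Sum.inl a)) r i v) = 0 := by
  rw [apply_eq_of_commute (commute_lowOp (fun c d => (commute_leftOp_dualOp hρ c d a b).symm) _),
    dualOp, LinearMap.neg_apply, hr' (ofDual b) (ofDual a) hab, neg_zero, map_zero]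

include hr hd' in
theorem rightOp_self_singularCoeff (a : Fin n) (i : Fin m) (j : Fin n) :
    rightOp ρ a a (singularCoeff ρ lam r s v i j) =
      (lam (Sum.inr a) + (if a = s then 1 else 0) - (if a = j then 1 else 0)) •
        singularCoeff ρ lam r s v i j := by
  have h := weight_lowOp (dualOp_mul hρ) hd' (dualOp_self_lowOp (r := r) hρ hr i)
    (toDual a) (toDual j)
  rw [dualOp, LinearMap.neg_apply, neg_eq_iff_eq_neg, ← neg_smul] at h
  rw [singularCoeff]
  simp only [ofDual_toDual, EmbeddingLike.apply_eq_iff_eq] at h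
  rw [h]
  congr 1
  ring

include hr hr' hd' in
theorem rightOp_singularCoeff {a b : Fin n} (hab : a < b) (i : Fin m) (j : Fin n) :
    rightOp ρ a b (singularCoeff ρ lam r s v i j) =
      -if j = a then singularCoeff ρ lam r s v i b else 0 := by
  have h := raise_lowOp (dualOp_mul hρ) hd' (dualOp_self_lowOp (r := r) hρ hr i)
    (dualOp_lowOp hρ hr' i) (toDual j) (toDual b) (toDual a) hab
  rw [dualOp, LinearMap.neg_apply, neg_eq_iff_eq_neg] at h
  simp only [ofDual_toDual, EmbeddingLike.apply_eq_iff_eq] at h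
  exact h

include hr hr' hd' in
theorem sum_rightOp_singularCoeff (i : Fin m) (c : Fin n) :
    ∑ j, rightOp ρ j c (singularCoeff ρ lam r s v i j) =
      (lam (Sum.inr s) - (#{j : Fin n | j < s} : k)) • singularCoeff ρ lam r s v i c := by
  have h := sum_univ_lowOp (dualOp_mul hρ) hd' (dualOp_self_lowOp (r := r) hρ hr i)
    (dualOp_lowOp hρ hr' i) (toDual c)
  simp only [dualOp, LinearMap.neg_apply, ofDual_toDual, sum_neg_distrib] at h
  rw [neg_eq_iff_eq_neg, ← neg_smul] at h
  have e : #{i : (Fin n)ᵒᵈ | toDual s < i} = #{j : Fin n | j < s} := rfl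
  rw [e, neg_add, neg_neg, ← sub_eq_add_neg] at h
  exact h

omit hρ in
theorem evenAct_singularVec (x : Even k m n) :
    evenAct ρ x (singularVec ρ lam r s v) =
      ∑ i, ∑ j, (extMul M (evenLow x (Matrix.single j i 1))
          (ExtTensor.mk k _ M 1 (singularCoeff ρ lam r s v i j)) +
        extMul M (Matrix.single j i (1 : k))
          (ExtTensor.mk k _ M 1 (ρ x (singularCoeff ρ lam r s v i j)))) := by
  rw [singularVec, map_sum]
  refine sum_congr rfl fun i _ => ?_
  rw [map_sum]
  refine sum_congr rfl fun j _ => ?_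
  rw [← Module.End.mul_apply, evenAct_mul_extMul, LinearMap.add_apply, Module.End.mul_apply,
    evenAct_one_tmul]

omit hρ in
theorem evenLow_left (a b : Fin m) (j : Fin n) (i : Fin m) :
    evenLow (Matrix.single a b (1 : k), 0) (Matrix.single j i 1) =
      if i = a then -Matrix.single j b 1 else 0 := by
  rw [evenLow_apply, Matrix.zero_mul, zero_sub]
  split_ifs with h
  · subst h; simp
  · simp [Matrix.single_mul_single_of_ne, h]

omit hρ in
theorem evenLow_right (a b : Fin n) (j : Fin n) (i : Fin m) :
    evenLow (0, Matrix.single a b (1 : k)) (Matrix.single j i 1) =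
      if b = j then Matrix.single a i 1 else 0 := by
  rw [evenLow_apply, Matrix.mul_zero, sub_zero]
  split_ifs with h
  · subst h; simp
  · simp [Matrix.single_mul_single_of_ne, h]

include hl hd hl' in
-- For `a < b`, `E_{ab}` sends `f_{ja}` to `-f_{jb}` and `m_{bj}` to `m_{aj}`, and the resulting
-- sums `∑_j f_{jb} ⊗ m_{aj}` cancel.
theorem evenAct_left_singularVec {a b : Fin m} (hab : a ≤ b) :
    evenAct ρ (Matrix.single a b 1, 0) (singularVec ρ lam r s v) =
      if a = b then (lam (Sum.inl a) - if a = r then 1 else 0) • singularVec ρ lam r s v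
        else 0 := by
  rw [evenAct_singularVec]
  simp only [sum_add_distrib, evenLow_left]
  rw [sum_eq_single a (fun i _ hi => sum_eq_zero fun j _ => by
    rw [if_neg hi, map_zero, LinearMap.zero_apply]) (by simp)]
  simp only [if_true, map_neg, LinearMap.neg_apply, sum_neg_distrib]
  change -_ + ∑ i, ∑ j, extMul M _ (ExtTensor.mk k _ M 1 (leftOp ρ a b _)) = _
  rcases hab.eq_or_lt with rfl | hab
  · rw [if_pos rfl]
    simp only [leftOp_self_singularCoeff hρ hl hd, add_smul, map_add, map_smul, sum_add_distrib,
      ← smul_sum, ite_smul, one_smul, zero_smul]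
    have : ∑ i, ∑ j, extMul M (Matrix.single j i (1 : k)) (ExtTensor.mk k _ M 1
        (if a = i then singularCoeff ρ lam r s v i j else 0)) =
        ∑ j, extMul M (Matrix.single j a (1 : k)) (ExtTensor.mk k _ M 1
          (singularCoeff ρ lam r s v a j)) := by
      rw [sum_eq_single a (fun i _ hi => sum_eq_zero fun j _ => by
        rw [if_neg hi.symm, map_zero, map_zero]) (by simp)]
      simp
    rw [this, neg_add_eq_sub, add_sub_cancel_right]
    rfl
  · rw [if_neg hab.ne, neg_add_eq_zero]
    rw [sum_eq_single b (fun i _ hi => sum_eq_zero fun j _ => by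
      rw [leftOp_singularCoeff hρ hl hl' hd hab, if_neg hi, map_zero, map_zero]) (by simp)]
    refine sum_congr rfl fun j _ => ?_
    rw [leftOp_singularCoeff hρ hl hl' hd hab, if_pos rfl]

include hr hr' hd' in
theorem evenAct_right_singularVec {a b : Fin n} (hab : a ≤ b) :
    evenAct ρ (0, Matrix.single a b 1) (singularVec ρ lam r s v) =
      if a = b then (lam (Sum.inr a) + if a = s then 1 else 0) • singularVec ρ lam r s v
        else 0 := by
  rw [evenAct_singularVec]
  simp only [sum_add_distrib, evenLow_right]
  have h1 : ∑ i, ∑ j, extMul M (if b = j then Matrix.single a i (1 : k) else 0)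
      (ExtTensor.mk k _ M 1 (singularCoeff ρ lam r s v i j)) =
      ∑ i, extMul M (Matrix.single a i (1 : k))
        (ExtTensor.mk k _ M 1 (singularCoeff ρ lam r s v i b)) := by
    refine sum_congr rfl fun i _ => ?_
    rw [sum_eq_single b (fun j _ hj => by
      rw [if_neg hj.symm, map_zero, LinearMap.zero_apply]) (by simp), if_pos rfl]
  rw [h1]
  change _ + ∑ i, ∑ j, extMul M _ (ExtTensor.mk k _ M 1 (rightOp ρ a b _)) = _
  rcases hab.eq_or_lt with rfl | hab
  · rw [if_pos rfl]
    simp only [rightOp_self_singularCoeff hρ hr hd', sub_smul, map_sub, map_smul, sum_sub_distrib,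
      ← smul_sum, ite_smul, one_smul, zero_smul]
    have : ∑ i, ∑ j, extMul M (Matrix.single j i (1 : k)) (ExtTensor.mk k _ M 1
        (if a = j then singularCoeff ρ lam r s v i j else 0)) =
        ∑ i, extMul M (Matrix.single a i (1 : k)) (ExtTensor.mk k _ M 1
          (singularCoeff ρ lam r s v i a)) := by
      refine sum_congr rfl fun i _ => ?_
      rw [sum_eq_single a (fun j _ hj => by
        rw [if_neg hj.symm, map_zero, map_zero]) (by simp), if_pos rfl]
    rw [this, add_sub_cancel]
    rfl
  · rw [if_neg hab.ne, ← sum_add_distrib]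
    refine sum_eq_zero fun i _ => ?_
    rw [sum_eq_single a (fun j _ hj => by
      rw [rightOp_singularCoeff hρ hr hr' hd' hab, if_neg hj, neg_zero, map_zero, map_zero])
      (by simp), rightOp_singularCoeff hρ hr hr' hd' hab, if_pos rfl, map_neg, map_neg,
      add_neg_cancel]

include hl hr hl' hr' hd hd' in
-- The unit `e_{ac}` kills the bottom, so only `[e_{ac}, f_{ji}]` acts, giving `E_{ai}` when `j = c`
-- and `E_{jc}` when `i = a`. Each of the two sums is a scalar multiple of `m_{ac}`, and `horth`
-- says that the scalars add up to zero.
theorem uppAct_singularVec (a : Fin m) (c : Fin n)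
    (horth : lam (Sum.inl r) + (#{i : Fin m | r < i} : k) +
      (lam (Sum.inr s) - (#{j : Fin n | j < s} : k)) = 0) :
    uppAct ρ (Matrix.single a c 1) (singularVec ρ lam r s v) = 0 := by
  have h1 (i : Fin m) (j : Fin n) : ρ (uppLow (Matrix.single a c (1 : k)) (Matrix.single j i 1)) =
      (if c = j then leftOp ρ a i else 0) + if i = a then rightOp ρ j c else 0 := by
    have e : uppLow (Matrix.single a c (1 : k)) (Matrix.single j i 1) =
        (if c = j then (Matrix.single a i 1, 0) else 0) +
          if i = a then (0, Matrix.single j c 1) else 0 := by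
      rw [uppLow_apply]
      by_cases hc : c = j
      · subst hc
        by_cases hi : i = a
        · subst hi; simp
        · simp [Matrix.single_mul_single_of_ne, hi]
      · by_cases hi : i = a
        · subst hi
          simp [Matrix.single_mul_single_of_ne, hc]
        · simp [Matrix.single_mul_single_of_ne, hi, hc]
    rw [e, map_add]
    congr 1 <;> split_ifs <;> first | rfl | exact map_zero ρ
  have h2 : uppAct ρ (Matrix.single a c 1) (singularVec ρ lam r s v) = ExtTensor.mk k _ M 1
      (∑ i, ∑ j, ρ (uppLow (Matrix.single a c (1 : k)) (Matrix.single j i 1))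
        (singularCoeff ρ lam r s v i j)) := by
    rw [singularVec, map_sum, map_sum]
    refine sum_congr rfl fun i _ => ?_
    rw [map_sum, map_sum]
    refine sum_congr rfl fun j _ => ?_
    rw [← Module.End.mul_apply, uppAct_mul_extMul, LinearMap.sub_apply, Module.End.mul_apply,
      uppAct_one_tmul, map_zero, sub_zero, evenAct_one_tmul]
  have h3 : ∑ i, ∑ j, ρ (uppLow (Matrix.single a c (1 : k)) (Matrix.single j i 1))
        (singularCoeff ρ lam r s v i j) =
      ∑ i, leftOp ρ a i (singularCoeff ρ lam r s v i c) +
        ∑ j, rightOp ρ j c (singularCoeff ρ lam r s v a j) := by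
    simp only [h1, LinearMap.add_apply, sum_add_distrib]
    congr 1
    · refine sum_congr rfl fun i _ => ?_
      rw [sum_eq_single c (fun j _ hj => by rw [if_neg hj.symm, LinearMap.zero_apply]) (by simp),
        if_pos rfl]
    · rw [sum_eq_single a (fun i _ hi => sum_eq_zero fun j _ => by
        rw [if_neg hi, LinearMap.zero_apply]) (by simp)]
      simp
  rw [h2, h3, sum_leftOp_singularCoeff hρ hl hl' hd, sum_rightOp_singularCoeff hρ hr hr' hd',
    ← add_smul, horth, zero_smul, map_zero]

end Singular

/-! ### The value of `ρ` -/

section Rho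

open Finset

variable {k : Type*} [Field k] {m n : ℕ}

theorem sum_root_apply (S : Finset (Idx m n × Idx m n)) (a : Idx m n) :
    (∑ q ∈ S, root k q) a =
      ∑ b, (if (a, b) ∈ S then (1 : k) else 0) - ∑ b, (if (b, a) ∈ S then (1 : k) else 0) := by
  have h1 : #{q ∈ S | q.1 = a} = #{b | (a, b) ∈ S} := by
    refine card_bij' (fun q _ => q.2) (fun b _ => (a, b)) ?_ ?_ ?_ ?_
    · rintro ⟨x, y⟩ h
      obtain ⟨h, rfl⟩ := mem_filter.1 h
      simpa using h
    · intro b h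
      simpa using h
    · rintro ⟨x, y⟩ h
      obtain ⟨h, rfl⟩ := mem_filter.1 h
      rfl
    · intro b h
      rfl
  have h2 : #{q ∈ S | q.2 = a} = #{b | (b, a) ∈ S} := by
    refine card_bij' (fun q _ => q.1) (fun b _ => (b, a)) ?_ ?_ ?_ ?_
    · rintro ⟨x, y⟩ h
      obtain ⟨h, rfl⟩ := mem_filter.1 h
      simpa using h
    · intro b h
      simpa using h
    · rintro ⟨x, y⟩ h
      obtain ⟨h, rfl⟩ := mem_filter.1 h
      rfl
    · intro b h
      rfl
  rw [Finset.sum_apply]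
  simp only [root, Pi.sub_apply, Pi.single_apply, sum_sub_distrib, @eq_comm _ a]
  rw [sum_boole, sum_boole, sum_boole, sum_boole, h1, h2]

theorem mem_evenPos {a b : Idx m n} :
    (a, b) ∈ evenPos m n ↔ pos a < pos b ∧ parity a = parity b := by
  simp [evenPos]

theorem mem_oddPos {a b : Idx m n} :
    (a, b) ∈ oddPos m n ↔ pos a < pos b ∧ parity a ≠ parity b := by
  simp [oddPos]

theorem rho_inl (r : Fin m) : rho k m n (Sum.inl r) =
    (1 / 2 : k) * (#{i : Fin m | r < i} - #{i : Fin m | i < r} - n) := by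
  rw [rho, Pi.sub_apply, Pi.smul_apply, Pi.smul_apply, sum_root_apply, sum_root_apply]
  have h1 (j : Fin n) : (r : ℕ) < m + j := r.2.trans_le (Nat.le_add_right _ _)
  simp only [Fintype.sum_sum_type, mem_evenPos, mem_oddPos, pos, parity, Sum.elim_inl,
    Sum.elim_inr, h1, (h1 _).not_gt]
  simp
  ring

theorem rho_inr (s : Fin n) : rho k m n (Sum.inr s) =
    (1 / 2 : k) * (#{j : Fin n | s < j} - #{j : Fin n | j < s} + m) := by
  rw [rho, Pi.sub_apply, Pi.smul_apply, Pi.smul_apply, sum_root_apply, sum_root_apply]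
  have h1 (j : Fin m) : (j : ℕ) < m + s := j.2.trans_le (Nat.le_add_right _ _)
  simp only [Fintype.sum_sum_type, mem_evenPos, mem_oddPos, pos, parity, Sum.elim_inl,
    Sum.elim_inr, h1, (h1 _).not_gt]
  simp
  ring

theorem card_lt_add_card_gt {q : ℕ} (a : Fin q) :
    #{i : Fin q | i < a} + #{i : Fin q | a < i} + 1 = q := by
  have h := card_filter_add_card_filter_not (s := (univ : Finset (Fin q))) (fun i => i < a)
  have h2 : filter (fun i => ¬ i < a) univ = insert a (filter (fun i => a < i) univ) := by
    ext i
    simp [le_iff_eq_or_lt, eq_comm]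
  rw [h2, card_insert_of_notMem (by simp), card_univ, Fintype.card_fin] at h
  omega

/-- The halves in `ρ` disappear after writing `m` and `n` as the number of indices below, above and
equal to `r` and `s`. -/
theorem form_add_rho [CharZero k] (lam : Weight k m n) (r : Fin m) (s : Fin n) :
    form (lam + rho k m n) (ε r - δ s) = lam (Sum.inl r) + (#{i : Fin m | r < i} : k) +
      (lam (Sum.inr s) - (#{j : Fin n | j < s} : k)) := by
  rw [form_sub_right, ε, δ, form_single_right, form_single_right]
  simp only [Sum.elim_inl, Sum.elim_inr, Pi.add_apply, rho_inl, rho_inr]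
  have h1 := congrArg (Nat.cast (R := k)) (card_lt_add_card_gt r)
  have h2 := congrArg (Nat.cast (R := k)) (card_lt_add_card_gt s)
  push_cast at h1 h2
  rw [← h1, ← h2]
  ring

end Rho

/-! ### Composition factors -/

/-- The cyclic module `R w` is `R` modulo the annihilator of `w`, so `f` factors through it. The
kernel of `R w → S` and `R w` itself form a chain of length one with factor `S`; it is strict
because `S` is nontrivial. -/
theorem multiplicity_ne_zero {R M S : Type*} [Ring R] [AddCommGroup M] [Module R M]
    [AddCommGroup S] [Module R S] [Nontrivial S] (w : M) (f : R →ₗ[R] S)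
    (hf : Function.Surjective f) (h : ∀ u : R, u • w = 0 → f u = 0) : multiplicity R M S ≠ 0 := by
  let t : R →ₗ[R] M := LinearMap.toSpanSingleton R M w
  have hker : LinearMap.ker t ≤ LinearMap.ker f := fun u hu => h u hu
  let φ : LinearMap.range t →ₗ[R] S :=
    (LinearMap.ker t).liftQ f hker ∘ₗ t.quotKerEquivRange.symm.toLinearMap
  have hφ : Function.Surjective φ := by
    have h1 : Function.Surjective ((LinearMap.ker t).liftQ f hker) := by
      intro y
      obtain ⟨u, rfl⟩ := hf y
      exact ⟨(LinearMap.ker t).mkQ u, by simp⟩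
    exact h1.comp t.quotKerEquivRange.symm.surjective
  let A : Submodule R M := (LinearMap.ker φ).map (LinearMap.range t).subtype
  have hA : A.submoduleOf (LinearMap.range t) = LinearMap.ker φ :=
    Submodule.comap_map_eq_of_injective (Submodule.injective_subtype _) _
  have hlt : A < LinearMap.range t := by
    refine lt_of_le_of_ne (Submodule.map_subtype_le _ _) fun e => ?_
    obtain ⟨y, hy⟩ := exists_ne (0 : S)
    obtain ⟨x, rfl⟩ := hφ y
    have hx : x ∈ A.submoduleOf (LinearMap.range t) := by
      rw [e]
      exact x.2
    rw [hA] at hx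
    exact hy hx
  let c : LTSeries (Submodule R M) := ⟨1, ![A, LinearMap.range t], fun i => by
    fin_cases i
    exact hlt⟩
  have hc : Nonempty ((↥(c (Fin.succ (0 : Fin 1))) ⧸
      (c (Fin.castSucc (0 : Fin 1))).submoduleOf (c (Fin.succ (0 : Fin 1)))) ≃ₗ[R] S) :=
    ⟨(Submodule.quotEquivOfEq _ _ hA).trans (φ.quotKerEquivOfSurjective hφ)⟩
  have hmem : (0 : Fin 1) ∈ {i : Fin c.length |
      Nonempty ((↥(c i.succ) ⧸ (c i.castSucc).submoduleOf (c i.succ)) ≃ₗ[R] S)} := hc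
  have h1 : (1 : ℕ∞) ≤ multiplicity R M S := by
    refine le_trans ?_ (le_iSup _ c)
    rw [Set.one_le_encard_iff_nonempty]
    exact ⟨_, hmem⟩
  intro h0
  rw [h0] at h1
  simp at h1

/-! ### The map from the Kac module to the model -/

section KacModel

variable {k : Type*} [Field k] {m n : ℕ}

/-- The inclusion of block diagonal matrices in `𝔤₀`. -/
def evenIncl : Even k m n →ₗ[k] (g₀ k m n).carrier where
  toFun x := ⟨Matrix.fromBlocks x.1 0 0 x.2, by
    rintro (i | i) (j | j) h
    · exact absurd (CharTwo.add_self_eq_zero _) h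
    · rfl
    · rfl
    · exact absurd (CharTwo.add_self_eq_zero _) h⟩
  map_add' x y := by
    apply Subtype.ext
    simp [Matrix.fromBlocks_add]
  map_smul' c x := by
    apply Subtype.ext
    simp [Matrix.fromBlocks_smul]

theorem coe_evenIncl (x : Even k m n) :
    (evenIncl x : Mat k m n) = Matrix.fromBlocks x.1 0 0 x.2 := rfl

variable (k m n)

variable (M : Type*) [AddCommGroup M] [Module k M] [Module (U (g₀ k m n)) M]
  [IsScalarTower k (U (g₀ k m n)) M]

/-- The action of block diagonal matrices on a module over the enveloping algebra of `𝔤₀`. -/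
def evenRep : Even k m n →ₗ[k] Module.End k M where
  toFun x := actBy M (ι (g₀ k m n) (evenIncl x))
  map_add' x y := by
    refine LinearMap.ext fun v => ?_
    change ι (g₀ k m n) _ • v = ι (g₀ k m n) _ • v + ι (g₀ k m n) _ • v
    rw [map_add, map_add, add_smul]
  map_smul' c x := by
    refine LinearMap.ext fun v => ?_
    change ι (g₀ k m n) (evenIncl (c • x)) • v = c • ι (g₀ k m n) (evenIncl x) • v
    rw [map_smul, map_smul, smul_assoc]

variable {k m n M}

theorem evenRep_apply (x : Even k m n) (v : M) :
    evenRep k m n M x v = ι (g₀ k m n) (evenIncl x) • v := rfl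

theorem evenRep_commutator (x y : Even k m n) :
    evenRep k m n M x * evenRep k m n M y - evenRep k m n M y * evenRep k m n M x = evenRep k m n M (x * y - y * x) := by
  refine LinearMap.ext fun v => ?_
  rw [LinearMap.sub_apply, Module.End.mul_apply, Module.End.mul_apply]
  simp only [evenRep_apply]
  have h := ι_mul_ι (g₀ k m n) 0 0 (evenIncl x) (evenIncl y) (evenIncl (x * y - y * x))
    (evenIncl x).2 (evenIncl y).2 (by
      simp [coe_evenIncl, bracket, sign, Matrix.fromBlocks_multiply, sub_eq_add_neg,
        Matrix.fromBlocks_add, Matrix.fromBlocks_neg])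
  rw [← mul_smul, ← mul_smul, ← sub_smul, h]
  simp [sign]

variable (k m n M)

/-- The model with its action of the enveloping algebra of `𝔤`. -/
def GModel := Model k m n M

instance : AddCommGroup (GModel k m n M) :=
  inferInstanceAs (AddCommGroup (Model k m n M))

instance : Module k (GModel k m n M) :=
  inferInstanceAs (Module k (Model k m n M))

/-- The action of the enveloping algebra on the model. -/
def modelHom : U (g k m n) →ₐ[k] Module.End k (GModel k m n M) :=
  liftU (A := Module.End k (Model k m n M)) (modelAct (evenRep k m n M) ∘ₗ (g k m n).carrier.subtype)
    (fun a b x y z hx hy hz => by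
      have := modelAct_mul (evenRep k m n M) evenRep_commutator a b (x : Mat k m n) y hx hy
      rwa [← hz] at this)

instance : Module (U (g k m n)) (GModel k m n M) :=
  Module.compHom _ (modelHom k m n M).toRingHom

instance : IsScalarTower k (U (g k m n)) (GModel k m n M) :=
  ⟨fun c u v => by
    change modelHom k m n M (c • u) v = c • modelHom k m n M u v
    rw [map_smul, LinearMap.smul_apply]⟩

variable {k m n M} in
theorem ι_smul_model (x : (g k m n).carrier) (w : GModel k m n M) :
    ι (g k m n) x • w = modelAct (evenRep k m n M) (x : Mat k m n) w := by
  change modelHom k m n M (ι _ x) w = _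
  rw [modelHom]
  erw [liftU_ι]
  rfl

/-- The bottom component of the model. -/
def bottom : M →ₗ[k] GModel k m n M := ExtTensor.mk k _ M 1

end KacModel

/-! ### The image of the Kac module in the model and its highest weight vector -/

section Kac

variable {k : Type*} [Field k] {m n : ℕ} (lam : Weight k m n)

instance : IsScalarTower k (U (g₀ k m n)) (L₀ lam) :=
  inferInstanceAs (IsScalarTower k (U (g₀ k m n)) (L (g₀ k m n) lam))

theorem p_smul_L₀ (a : U (p k m n)) (v : L₀ lam) : a • v = projU k m n a • v := rfl

theorem inclU_ι (x : (p k m n).carrier) :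
    inclU k m n (ι (p k m n) x) = ι (g k m n) ⟨x, Submodule.mem_top⟩ := mapU_ι _ _ _ x

theorem projU_ι (x : (p k m n).carrier) :
    projU k m n (ι (p k m n) x) = ι (g₀ k m n) ⟨diagPart (x : Mat k m n), diagPart_mem _⟩ :=
  mapU_ι _ _ _ x

/-- The bottom component is a copy of `L⁰(λ)` as a `𝔭`-module, which is what the universal property
of the induced module requires. -/
theorem inclU_smul_bottom (a : U (p k m n)) (v : L₀ lam) :
    inclU k m n a • bottom k m n (L₀ lam) v = bottom k m n (L₀ lam) (a • v) := by
  rw [p_smul_L₀]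
  induction a using U_induction generalizing v with
  | algebraMap c => rw [AlgHom.commutes, AlgHom.commutes, algebraMap_smul, algebraMap_smul,
      map_smul]
  | add a b ha hb => rw [map_add, map_add, add_smul, add_smul, map_add, ha, hb]
  | mul a b ha hb => rw [map_mul, map_mul, mul_smul, mul_smul, hb, ha]
  | ι x =>
    rw [inclU_ι, projU_ι, ι_smul_model]
    have h1 : Matrix.toBlocks₂₁ (x : Mat k m n) = 0 := by
      ext i j
      exact x.2 i j
    change (evenAct (evenRep k m n (L₀ lam))
        (Matrix.toBlocks₁₁ (x : Mat k m n), Matrix.toBlocks₂₂ (x : Mat k m n)) +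
      extMul (L₀ lam) (Matrix.toBlocks₂₁ (x : Mat k m n)) +
      uppAct (evenRep k m n (L₀ lam)) (Matrix.toBlocks₁₂ (x : Mat k m n)) :
        Module.End k (Model k m n (L₀ lam))) (ExtTensor.mk k _ (L₀ lam) 1 v) = _
    rw [h1, map_zero, add_zero, LinearMap.add_apply, uppAct_one_tmul, add_zero, evenAct_one_tmul,
      evenRep_apply]
    change ExtTensor.mk k _ _ 1 _ = ExtTensor.mk k _ _ 1 _
    congr 3
    apply Subtype.ext
    rw [coe_evenIncl]
    change _ = diagPart (x : Mat k m n)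
    ext (i | i) (j | j) <;> simp [diagPart_apply, parity, Matrix.toBlocks₁₁, Matrix.toBlocks₂₂]

/-- The map from `U(𝔤) ⊗ L⁰(λ)` to the model. -/
def kacLift : U (g k m n) ⊗[k] L₀ lam →ₗ[U (g k m n)] GModel k m n (L₀ lam) :=
  TensorProduct.AlgebraTensorModule.lift
    { toFun := fun b => actBy (GModel k m n (L₀ lam)) b ∘ₗ bottom k m n (L₀ lam)
      map_add' := fun b b' => LinearMap.ext fun v => add_smul b b' (bottom k m n (L₀ lam) v)
      map_smul' := fun b b' => LinearMap.ext fun v => by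
        change (b * b') • bottom k m n (L₀ lam) v = b • b' • bottom k m n (L₀ lam) v
        rw [mul_smul] }

theorem kacLift_tmul (b : U (g k m n)) (v : L₀ lam) :
    kacLift lam (b ⊗ₜ v) = b • bottom k m n (L₀ lam) v := rfl

/-- The map from the Kac module to the model. -/
def kacMap : KacModule lam →ₗ[U (g k m n)] GModel k m n (L₀ lam) :=
  (balanced (inclU k m n) (L₀ lam)).liftQ (kacLift lam) (by
    rw [balanced, Submodule.span_le]
    rintro _ ⟨b, a, v, rfl⟩
    simp only [SetLike.mem_coe, LinearMap.mem_ker, map_sub, kacLift_tmul, mul_smul,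
      inclU_smul_bottom, sub_self])

/-- The highest weight vector of `L⁰(λ)`. -/
def topVec : L₀ lam :=
  (sSup {N : Submodule (U (g₀ k m n)) (Verma (g₀ k m n) lam) | N ≠ ⊤}).mkQ
    (vermaVec (g₀ k m n) lam)

variable {lam}

theorem topVec_ne_zero [CharZero k] (hlam : IsDominant lam) : topVec lam ≠ 0 := by
  intro h
  refine vermaVec_notMem_sSup isRegular_g₀ lam hlam.vermaVec_ne_zero ?_
  exact (Submodule.Quotient.mk_eq_zero _).1 h

theorem single_smul_topVec {i j : Idx m n} (hij : pos i ≤ pos j)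
    (h : Matrix.single i j (1 : k) ∈ (g₀ k m n).carrier) :
    ι (g₀ k m n) ⟨_, h⟩ • topVec lam = if i = j then lam i • topVec lam else 0 := by
  have h1 := isHighestWeight_vermaVec (s := g₀ k m n) lam ⟨_, h⟩ (by
    intro a b hab
    refine Matrix.single_apply_of_ne _ _ _ _ _ ?_
    rintro ⟨rfl, rfl⟩
    omega)
  rw [evalDiag_single] at h1
  have h2 := congrArg
    (sSup {N : Submodule (U (g₀ k m n)) (Verma (g₀ k m n) lam) | N ≠ ⊤}).mkQ h1
  rw [map_smul] at h2
  refine Eq.trans h2 ?_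
  rw [ite_smul, zero_smul]
  split_ifs
  · rfl
  · exact map_zero _

theorem leftOp_topVec {a b : Fin m} (hab : a ≤ b) :
    leftOp (evenRep k m n (L₀ lam)) a b (topVec lam) =
      if a = b then lam (Sum.inl a) • topVec lam else 0 := by
  rw [leftOp, evenRep_apply]
  have h : evenIncl (Matrix.single a b (1 : k), (0 : Matrix (Fin n) (Fin n) k)) =
      ⟨_, single_mem_g₀ (i := Sum.inl a) (j := Sum.inl b) rfl⟩ := by
    apply Subtype.ext
    rw [coe_evenIncl]
    ext (i | i) (j | j) <;> simp [Matrix.single_apply]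
  rw [h, single_smul_topVec (i := Sum.inl a) (j := Sum.inl b) hab]
  simp

theorem rightOp_topVec {a b : Fin n} (hab : a ≤ b) :
    rightOp (evenRep k m n (L₀ lam)) a b (topVec lam) =
      if a = b then lam (Sum.inr a) • topVec lam else 0 := by
  rw [rightOp, evenRep_apply]
  have h : evenIncl ((0 : Matrix (Fin m) (Fin m) k), Matrix.single a b (1 : k)) =
      ⟨_, single_mem_g₀ (i := Sum.inr a) (j := Sum.inr b) rfl⟩ := by
    apply Subtype.ext
    rw [coe_evenIncl]
    ext (i | i) (j | j) <;> simp [Matrix.single_apply]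
  rw [h, single_smul_topVec (i := Sum.inr a) (j := Sum.inr b) (Nat.add_le_add_left hab _)]
  simp

/-- The singular vector of the Kac module. -/
def kacVec (lam : Weight k m n) (r : Fin m) (s : Fin n) : KacModule lam :=
  (balanced (inclU k m n) (L₀ lam)).mkQ (∑ i, ∑ j,
    ι (g k m n) ⟨Matrix.single (Sum.inr j) (Sum.inl i) 1, Submodule.mem_top⟩ ⊗ₜ[k]
      singularCoeff (evenRep k m n (L₀ lam)) lam r s (topVec lam) i j)

theorem modelAct_lower {M : Type*} [AddCommGroup M] [Module k M]
    (ρ : Even k m n →ₗ[k] Module.End k M) (j : Fin n) (i : Fin m) :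
    modelAct ρ (Matrix.single (Sum.inr j) (Sum.inl i) 1) = extMul M (Matrix.single j i (1 : k)) := by
  have h : (Matrix.single (Sum.inr j) (Sum.inl i) (1 : k) : Mat k m n) =
      Matrix.fromBlocks (0 : Matrix (Fin m) (Fin m) k) 0 (Matrix.single j i 1) 0 := by
    ext (i | i) (j | j) <;> simp [Matrix.single_apply]
  rw [h, modelAct_fromBlocks, evenAct_zero_zero, map_zero, zero_add, add_zero]

theorem modelAct_left {M : Type*} [AddCommGroup M] [Module k M]
    (ρ : Even k m n →ₗ[k] Module.End k M) (a b : Fin m) :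
    modelAct ρ (Matrix.single (Sum.inl a) (Sum.inl b) 1) =
      evenAct ρ (Matrix.single a b (1 : k), 0) := by
  have h : (Matrix.single (Sum.inl a) (Sum.inl b) (1 : k) : Mat k m n) =
      Matrix.fromBlocks (Matrix.single a b 1) 0 0 (0 : Matrix (Fin n) (Fin n) k) := by
    ext (i | i) (j | j) <;> simp [Matrix.single_apply]
  rw [h, modelAct_fromBlocks, map_zero, map_zero, add_zero, add_zero]

theorem modelAct_right {M : Type*} [AddCommGroup M] [Module k M]
    (ρ : Even k m n →ₗ[k] Module.End k M) (a b : Fin n) :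
    modelAct ρ (Matrix.single (Sum.inr a) (Sum.inr b) 1) =
      evenAct ρ (0, Matrix.single a b (1 : k)) := by
  have h : (Matrix.single (Sum.inr a) (Sum.inr b) (1 : k) : Mat k m n) =
      Matrix.fromBlocks (0 : Matrix (Fin m) (Fin m) k) 0 0 (Matrix.single a b 1) := by
    ext (i | i) (j | j) <;> simp [Matrix.single_apply]
  rw [h, modelAct_fromBlocks, map_zero, map_zero, add_zero, add_zero]

theorem modelAct_upper {M : Type*} [AddCommGroup M] [Module k M]
    (ρ : Even k m n →ₗ[k] Module.End k M) (i : Fin m) (j : Fin n) :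
    modelAct ρ (Matrix.single (Sum.inl i) (Sum.inr j) 1) = uppAct ρ (Matrix.single i j (1 : k)) := by
  have h : (Matrix.single (Sum.inl i) (Sum.inr j) (1 : k) : Mat k m n) =
      Matrix.fromBlocks (0 : Matrix (Fin m) (Fin m) k) (Matrix.single i j 1) 0 0 := by
    ext (i | i) (j | j) <;> simp [Matrix.single_apply]
  rw [h, modelAct_fromBlocks, evenAct_zero_zero, map_zero, zero_add, zero_add]

theorem kacMap_kacVec (r : Fin m) (s : Fin n) :
    kacMap lam (kacVec lam r s) = singularVec (evenRep k m n (L₀ lam)) lam r s (topVec lam) := by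
  rw [kacMap, kacVec, Submodule.mkQ_apply, Submodule.liftQ_apply, map_sum]
  refine Finset.sum_congr rfl fun i _ => ?_
  rw [map_sum]
  refine Finset.sum_congr rfl fun j _ => ?_
  rw [kacLift_tmul, ι_smul_model, modelAct_lower]
  rfl

/-- Dominance of `λ - ε_r + δ_s` makes `λ_r - λ_j` at least `1`; dominance of `λ` alone would allow
a zero denominator at `j = r + 1`. -/
theorem lowDen_left_ne_zero [CharZero k] {r : Fin m} {s : Fin n}
    (hmu : IsDominant (lam - ε r + δ s)) (j : Fin m) (hj : r < j) :
    lowDen (fun a => lam (Sum.inl a)) r j ≠ 0 := by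
  obtain ⟨N, hN⟩ := hmu.exists_nat (i := Sum.inl r) (j := Sum.inl j) hj rfl
  simp only [Pi.add_apply, Pi.sub_apply, ε, δ, Pi.single_apply, Sum.inl.injEq, if_true,
    if_neg hj.ne', reduceCtorEq, if_false] at hN
  have h : lam (Sum.inl r) - lam (Sum.inl j) = N + 1 := by
    rw [← hN]
    ring
  rw [lowDen, h]
  norm_cast
  omega

open OrderDual in
-- Adding `δ_s` raises entry `s`, so dominance of the sum forces `λ_j - λ_s ≥ 1` for `j` before `s`.
theorem lowDen_right_ne_zero [CharZero k] {r : Fin m} {s : Fin n}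
    (hmu : IsDominant (lam - ε r + δ s)) (j : (Fin n)ᵒᵈ) (hj : toDual s < j) :
    lowDen (fun a : (Fin n)ᵒᵈ => -lam (Sum.inr (ofDual a))) (toDual s) j ≠ 0 := by
  have hj' : ofDual j < s := hj
  obtain ⟨N, hN⟩ := hmu.exists_nat (i := Sum.inr (ofDual j)) (j := Sum.inr s)
    (Nat.add_lt_add_left hj' _) rfl
  simp only [Pi.add_apply, Pi.sub_apply, ε, δ, Pi.single_apply, Sum.inr.injEq, if_true,
    if_neg hj'.ne, reduceCtorEq, if_false] at hN
  have h : -lam (Sum.inr (ofDual (toDual s))) - -lam (Sum.inr (ofDual j)) = N + 1 := by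
    rw [← hN, ofDual_toDual]
    ring
  rw [lowDen, h]
  norm_cast
  omega

theorem isHighestWeight_singularVec [CharZero k] {r : Fin m} {s : Fin n}
    (hmu : IsDominant (lam - ε r + δ s))
    (horth : form (lam + rho k m n) (ε r - δ s) = 0) :
    IsHighestWeight (g k m n) (lam - ε r + δ s)
      (show GModel k m n (L₀ lam) from
        singularVec (evenRep k m n (L₀ lam)) lam r s (topVec lam)) := by
  have hl : ∀ a, leftOp (evenRep k m n (L₀ lam)) a a (topVec lam) =
      lam (Sum.inl a) • topVec lam := fun a => by rw [leftOp_topVec le_rfl, if_pos rfl]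
  have hr : ∀ a, rightOp (evenRep k m n (L₀ lam)) a a (topVec lam) =
      lam (Sum.inr a) • topVec lam := fun a => by rw [rightOp_topVec le_rfl, if_pos rfl]
  have hl' : ∀ a b, a < b → leftOp (evenRep k m n (L₀ lam)) a b (topVec lam) = 0 :=
    fun a b h => by rw [leftOp_topVec h.le, if_neg h.ne]
  have hr' : ∀ a b, a < b → rightOp (evenRep k m n (L₀ lam)) a b (topVec lam) = 0 :=
    fun a b h => by rw [rightOp_topVec h.le, if_neg h.ne]
  have hd := lowDen_left_ne_zero hmu
  have hd' := lowDen_right_ne_zero hmu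
  rw [form_add_rho] at horth
  refine isHighestWeight_of_single isRegular_g fun i j h hij => ?_
  rw [ι_smul_model]
  rcases i with i | i <;> rcases j with j | j
  · have h1 := evenAct_left_singularVec (s := s) evenRep_commutator hl hl' hd
      (show i ≤ j from hij)
    rw [modelAct_left]
    refine h1.trans ?_
    simp only [Sum.inl.injEq]
    congr 2
    simp [ε, δ, Pi.single_apply]
  · rw [modelAct_upper, if_neg (by simp)]
    exact uppAct_singularVec evenRep_commutator hl hr hl' hr' hd hd' i j horth
  · exfalso
    have h1 : m + (i : ℕ) ≤ j := hij
    have := j.2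
    omega
  · have h1 := evenAct_right_singularVec (r := r) evenRep_commutator hr hr' hd'
      (show i ≤ j from Nat.le_of_add_le_add_left hij)
    rw [modelAct_right]
    refine h1.trans ?_
    simp only [Sum.inr.injEq]
    congr 2
    simp [ε, δ, Pi.single_apply]

end Kac

end GLSuper

end

/-! ### The composition factor -/

theorem theorem9p4 {k : Type*} [Field k] [IsAlgClosed k] [CharZero k] (m n : ℕ)
    (r : Fin m) (s : Fin n) (lam : GLSuper.Weight k m n)
    (hlam : GLSuper.IsDominant lam)
    (hmu : GLSuper.IsDominant (lam - GLSuper.ε r + GLSuper.δ s))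
    (horth : GLSuper.form (lam + GLSuper.rho k m n) (GLSuper.ε r - GLSuper.δ s) = 0) :
    IsSimpleModule (GLSuper.U (GLSuper.g k m n))
        (GLSuper.L (GLSuper.g k m n) (lam - GLSuper.ε r + GLSuper.δ s)) ∧
      GLSuper.multiplicity (GLSuper.U (GLSuper.g k m n)) (GLSuper.KacModule lam)
        (GLSuper.L (GLSuper.g k m n) (lam - GLSuper.ε r + GLSuper.δ s)) ≠ 0 := by
  have hw := GLSuper.isHighestWeight_singularVec hmu horth
  have h0 := GLSuper.singularVec_ne_zero (GLSuper.evenRep k m n (GLSuper.L₀ lam)) lam r s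
    (GLSuper.topVec_ne_zero hlam)
  have hsimple := GLSuper.isSimpleModule_L GLSuper.isRegular_g hw h0
  refine ⟨hsimple, ?_⟩
  have := IsSimpleModule.nontrivial (GLSuper.U (GLSuper.g k m n))
    (GLSuper.L (GLSuper.g k m n) (lam - GLSuper.ε r + GLSuper.δ s))
  refine GLSuper.multiplicity_ne_zero (GLSuper.kacVec lam r s)
    (Submodule.mkQ _ ∘ₗ Submodule.mkQ _)
    ((Submodule.mkQ_surjective _).comp (Submodule.mkQ_surjective _)) fun u hu => ?_
  -- An element that kills `kacVec` in the Kac module also kills its image in the model, where the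
  -- highest weight property is known.
  refine GLSuper.mkQ_eq_zero_of_smul_eq_zero hw h0 ?_
  have h1 := congrArg (GLSuper.kacMap lam) hu
  rw [map_smul, map_zero, GLSuper.kacMap_kacVec] at h1
  exact h1
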